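/- Let $d\ge 2$, let $\mathbb T$ be the infinite $(d+1)$-regular tree with root $o$, let $\bar o$ be a fixed neighbour of $o$, and let $\mathbb T^+$ be the set of vertices $x$ such that $\bar o$ does not lie on the geodesic from $o$ to $x$. Fix $\kappa>0$. Let $P$ be the law on $\mathbb R^{\mathbb T}$ of the Gaussian free field $\phi=(\phi_x)_{x\in\mathbb T}$, that is, of the centred Gaussian process with covariance $$E[\phi_x\phi_y]=\kappa\,\mathbb E_x\Big[\sum_{k\ge 0}1_{X_k=y}\Big],$$ where $(X_k)_{k\ge0}$ is the simple random walk on $\mathbb T$ started at $x$ under $\mathbb{E}_x$ (different $\kappa$ correspond to different normalisations of the Green function). For $a\in\mathbb R$ let $P_a$ be the conditional law of $\phi$ given $\phi_o=a$, explicitly the law of the field defined by $\phi_o=a$ and $\phi_x=\frac1d\phi_{\bar x}+Y_x$ for $x\ne o$, where $\bar x$ is the neighbour of $x$ on the geodesic from $x$ to $o$ and the $Y_x$ are independent centred Gaussian variables with variance $\kappa\frac{d+1}{d}$. For $h\in\mathbb R$ let $\mathcal C_o^h$ be the connected component of $o$ in $\{x\in\mathbb T:\phi_x\ge h\}$ (empty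 if $\phi_o<h$), and let $$h^*=\inf\{h\in\mathbb R: P[|\mathcal C_o^h|=\infty]=0\}.$$ Then $h^*$ is a well-defined real number (the set is non-empty and bounded below), and there is no percolation at level $h^*$: for every $a\in\mathbb R$, $$P_a[|\mathcal C_o^{h^*}|=\infty]=P_a[|\mathcal C_o^{h^*}\cap\mathbb T^+|=\infty]=0,$$ and, as a consequence, $$P[|\mathcal C_o^{h^*}\cap\mathbb T^+|=\infty]=P[|\mathcal C_o^{h^*}|=\infty]=0.$$ -/

import Mathlib

open MeasureTheory ProbabilityTheory
open scoped NNReal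

namespace TreeGFF

variable {V : Type*}

section SimpleRandomWalk

open Classical in
/-- `stepProb T k x y` is the probability that the simple random walk on the locally finite
graph `T`, started at `x`, is at `y` at time `k`. -/
noncomputable def stepProb (T : SimpleGraph V) [T.LocallyFinite] : ℕ → V → V → ℝ
  | 0, x, y => if x = y then 1 else 0
  | k + 1, x, y => (∑ z ∈ T.neighborFinset x, stepProb T k z y) / (T.degree x : ℝ)

/-- The expected number of visits to `y` of the simple random walk started at `x`. The series
converges on the trees considered below, where the walk is transient. -/
noncomputable def expectedVisits (T : SimpleGraph V) [T.LocallyFinite] (x y : V) : ℝ :=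
  ∑' k : ℕ, stepProb T k x y

end SimpleRandomWalk

/-- `P` is the law on `V → ℝ` of the Gaussian free field on `T`: the coordinate process is a
centred Gaussian process whose covariance function is the Green function of the simple random
walk, with normalising factor `κ`. -/
structure IsGFF (T : SimpleGraph V) [T.LocallyFinite] (κ : ℝ≥0) (P : Measure (V → ℝ)) :
    Prop where
  isProbabilityMeasure : IsProbabilityMeasure P
  gaussian : IsGaussianProcess (fun (x : V) (φ : V → ℝ) => φ x) P
  centred : ∀ x, ∫ φ, φ x ∂P = 0
  covariance : ∀ x y, ∫ φ, φ x * φ y ∂P = (κ : ℝ) * expectedVisits T x y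

section ConditionedField

open Classical in
/-- The direct ancestor of `x ≠ o`: the neighbour of `x` which is closer to the root `o`
(and `x` itself if there is none). -/
noncomputable def parent (T : SimpleGraph V) (o x : V) : V :=
  if h : ∃ y, T.Adj x y ∧ T.dist o x = T.dist o y + 1 then h.choose else x

/-- Auxiliary recursion along the ancestors: `fieldAux T d o a Y n x` is the value at a vertex
`x` of generation `n`. -/
noncomputable def fieldAux (T : SimpleGraph V) (d : ℕ) (o : V) (a : ℝ) (Y : V → ℝ) :
    ℕ → V → ℝ
  | 0, _ => a
  | n + 1, x => (1 / (d : ℝ)) * fieldAux T d o a Y n (parent T o x) + Y x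

/-- The field with `φ o = a` and `φ x = φ (parent x) / d + Y x` for `x ≠ o`. -/
noncomputable def field (T : SimpleGraph V) (d : ℕ) (o : V) (a : ℝ) (Y : V → ℝ) : V → ℝ :=
  fun x => fieldAux T d o a Y (T.dist o x) x

/-- `P_a`, the conditional law of the field given `φ o = a`: the law of the field built
recursively from the root value `a` and independent centred Gaussian innovations `Y x` of
variance `κ (d + 1) / d`. -/
noncomputable def condLaw (T : SimpleGraph V) (d : ℕ) (κ : ℝ≥0) (o : V) (a : ℝ) :
    Measure (V → ℝ) :=
  (Measure.infinitePi (fun _ : V => gaussianReal 0 (κ * ((d : ℝ≥0) + 1) / (d : ℝ≥0)))).map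
    (field T d o a)

theorem measurable_fieldAux (T : SimpleGraph V) (d : ℕ) (o : V) (a : ℝ) (n : ℕ) :
    ∀ x, Measurable (fun Y : V → ℝ => fieldAux T d o a Y n x) := by
  induction n with
  | zero => intro x; exact measurable_const
  | succ n ih =>
    intro x
    exact ((ih (parent T o x)).const_mul _).add (measurable_pi_apply x)

theorem measurable_field (T : SimpleGraph V) (d : ℕ) (o : V) (a : ℝ) :
    Measurable (field T d o a) :=
  measurable_pi_lambda _ fun x => measurable_fieldAux T d o a (T.dist o x) x

instance isProbabilityMeasure_condLaw (T : SimpleGraph V) (d : ℕ) (κ : ℝ≥0) (o : V) (a : ℝ) :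
    IsProbabilityMeasure (condLaw T d κ o a) :=
  Measure.isProbabilityMeasure_map (measurable_field T d o a).aemeasurable

end ConditionedField

section Percolation

/-- The level set of `φ` above level `h`. -/
def levelSet (h : ℝ) (φ : V → ℝ) : Set V := {x | h ≤ φ x}

/-- The connected component of `o` in the level set of `φ` above level `h`
(empty if `φ o < h`). -/
def cluster (T : SimpleGraph V) (o : V) (h : ℝ) (φ : V → ℝ) : Set V :=
  {y | ∃ p : T.Walk o y, ∀ z ∈ p.support, z ∈ levelSet h φ}

/-- The forward tree: the vertices `x` such that `obar` is not on the geodesic from `o`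
to `x`. -/
def forwardTree (T : SimpleGraph V) (o obar : V) : Set V :=
  {x | ∀ p : T.Walk o x, p.length = T.dist o x → obar ∉ p.support}

/-- The levels at which the field with law `P` almost surely does not percolate. -/
def subcriticalLevels (T : SimpleGraph V) (o : V) (P : Measure (V → ℝ)) : Set ℝ :=
  {h | P {φ | (cluster T o h φ).Infinite} = 0}

/-- The critical height `h*`. -/
noncomputable def criticalHeight (T : SimpleGraph V) (o : V) (P : Measure (V → ℝ)) : ℝ :=
  sInf (subcriticalLevels T o P)

/-- The conditioned percolation probability `η(h, a)`. -/
noncomputable def eta (T : SimpleGraph V) (d : ℕ) (κ : ℝ≥0) (o : V) (h a : ℝ) : ℝ :=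
  (condLaw T d κ o a).real {φ | (cluster T o h φ).Infinite}

/-- The conditioned forward percolation probability `η⁺(h, a)`. -/
noncomputable def etaPlus (T : SimpleGraph V) (d : ℕ) (κ : ℝ≥0) (o obar : V) (h a : ℝ) : ℝ :=
  (condLaw T d κ o a).real {φ | (cluster T o h φ ∩ forwardTree T o obar).Infinite}

end Percolation

end TreeGFF

/-!
The field under `condLaw` is a branching process whose types are the values of the field: a vertex
of value `b ≥ h` has `d` children, whose values `b / d + Y` are independent, and a child survives
if its value is at least `h`. Hence the probability `surv d γ h n b` of a line of descent of length
`n` above `h` satisfies the recursion `s ↦ 1 - (1 - childMean s) ^ d` on `[h, ∞)`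
(`prob_lineAbove_eq_surv`), and the forward percolation function is its limit `survLim`
(`etaPlus_eq`), a fixed point of the recursion.

The heart of the argument is that survival is an *open* condition in the level
(`exists_gt_survLim_pos`); no spectral theory is needed. If `s = survLim d γ h` is not zero, then,
by monotonicity in the starting value, any child of a vertex with value at least `h` survives with
probability `p ≥ p₀ > 0`. The mean number `d * p` of surviving children exceeds the probability
`s = 1 - (1 - p) ^ d` of having at least one by at least `p ^ 2`, so `s ≤ (d - p₀) * childMean s`.
This strict inequality survives a small increase of the level, because the Gaussian density is
bounded and `childMean s ≥ p₀`. A small multiple of `s` is then a subsolution of the recursion at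
the higher level, which forces survival there (`exists_mul_le_survLim`). Consequently there is no
survival at the infimum of the levels without survival. The set of these levels is non-empty
because `exp` is a supersolution at high levels, and bounded below because `1` is a subsolution at
low levels.

To pass to the law `P` of the free field, the Green function of the walk is computed to be
`d / (d - 1) * d ^ (-dist x y)` (`expectedVisits_eq`). It follows that under `P` the root value and
the innovations `φ x - φ (parent x) / d` are uncorrelated, hence independent, Gaussian variables
(`IsGFF.map_rootedInnovation`), so that `P` is the mixture of the laws `condLaw` over a
non-degenerate Gaussian root value (`IsGFF.measure_infinite_eq_lintegral`), and the levels without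
percolation under `P` are exactly those at which `survLim` vanishes
(`IsGFF.mem_subcriticalLevels_iff`).
-/

namespace TreeGFF

/-! ### Distances in a tree -/

section Tree

variable {V : Type*} {T : SimpleGraph V}

lemma exists_adj_dist_eq_succ (hc : T.Connected) {o x : V} (hx : x ≠ o) :
    ∃ y, T.Adj x y ∧ T.dist o x = T.dist o y + 1 := by
  obtain ⟨p, hp⟩ := hc.exists_walk_length_eq_dist x o
  cases p with
  | nil => exact absurd rfl hx
  | cons h q =>
    rename_i y
    refine ⟨y, h, ?_⟩
    have h1 := SimpleGraph.dist_le q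
    have h2 : T.dist x o ≤ T.dist x y + T.dist y o := hc.dist_triangle
    have h3 : T.dist x y = 1 := SimpleGraph.dist_eq_one_iff_adj.2 h
    rw [SimpleGraph.Walk.length_cons] at hp
    rw [SimpleGraph.dist_comm (u := o) (v := x), SimpleGraph.dist_comm (u := o) (v := y)]
    omega

lemma eq_of_adj_of_dist_eq_succ (hT : T.IsTree) {o x y z : V} (hy : T.Adj x y)
    (hyd : T.dist o x = T.dist o y + 1) (hz : T.Adj x z) (hzd : T.dist o x = T.dist o z + 1) :
    y = z := by
  obtain ⟨p, hp, hpl⟩ := hT.connected.exists_path_of_dist o y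
  obtain ⟨q, hq, hql⟩ := hT.connected.exists_path_of_dist o z
  have aux : ∀ {w : V} (r : T.Walk o w), r.length = T.dist o w → T.dist o x = T.dist o w + 1 →
      x ∉ r.support := by
    classical
    intro w r hr hw hmem
    have h1 := SimpleGraph.dist_le (r.takeUntil x hmem)
    have h2 := r.length_takeUntil_le_length hmem
    omega
  have hp' : (p.concat hy.symm).IsPath := hp.concat (aux p hpl hyd) hy.symm
  have hq' : (q.concat hz.symm).IsPath := hq.concat (aux q hql hzd) hz.symm
  have := (hT.existsUnique_path o x).unique hp' hq'
  have h2 := congrArg SimpleGraph.Walk.penultimate this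
  simpa using h2

lemma parent_spec (hT : T.IsTree) {o x : V} (hx : x ≠ o) :
    T.Adj x (parent T o x) ∧ T.dist o x = T.dist o (parent T o x) + 1 := by
  have h := exists_adj_dist_eq_succ hT.connected hx
  unfold parent
  rw [dif_pos h]
  exact h.choose_spec

lemma parent_self (o : V) : parent T o o = o := by
  unfold parent
  rw [dif_neg]
  simp

lemma eq_parent (hT : T.IsTree) {o x y : V} (h : T.Adj x y) (hd : T.dist o x = T.dist o y + 1) :
    parent T o x = y := by
  have hx : x ≠ o := by rintro rfl; simp at hd
  exact eq_of_adj_of_dist_eq_succ hT (parent_spec hT hx).1 (parent_spec hT hx).2 h hd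

lemma parent_of_adj_root (hT : T.IsTree) {o x : V} (h : T.Adj o x) : parent T o x = o := by
  refine eq_parent hT h.symm ?_
  simp [SimpleGraph.dist_eq_one_iff_adj.2 h]

/-- If the parent of `x` is farther from `z` than `x` itself, then `x` lies on the geodesic from
the root to `z`. -/
lemma dist_root_eq_add (hT : T.IsTree) {o x : V} (hx : x ≠ o) (n : ℕ) :
    ∀ z, T.dist x z = n → T.dist (parent T o x) z = T.dist x z + 1 →
      T.dist o z = T.dist o x + n := by
  have hc := hT.connected
  induction n using Nat.strong_induction_on with
  | _ n ih =>
    intro z hz hpz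
    rcases Nat.eq_zero_or_pos n with rfl | hn
    · rw [(hc.dist_eq_zero_iff).1 hz]; rfl
    · -- one step back from `z` towards `x`
      have key : ∀ w, w ≠ x → T.dist (parent T o x) w = T.dist x w + 1 →
          ∃ w', T.Adj w w' ∧ T.dist x w = T.dist x w' + 1 ∧
            T.dist (parent T o x) w' = T.dist x w' + 1 := by
        intro w hw hpw
        obtain ⟨w', hadj, hd⟩ := exists_adj_dist_eq_succ hc hw
        refine ⟨w', hadj, hd, ?_⟩
        have h1 : T.dist (parent T o x) w ≤ T.dist (parent T o x) w' + T.dist w' w :=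
          hc.dist_triangle
        have h2 : T.dist w' w = 1 := SimpleGraph.dist_eq_one_iff_adj.2 hadj.symm
        have h3 : T.dist (parent T o x) w' ≤ T.dist (parent T o x) x + T.dist x w' :=
          hc.dist_triangle
        have h4 : T.dist (parent T o x) x = 1 :=
          SimpleGraph.dist_eq_one_iff_adj.2 (parent_spec hT hx).1.symm
        omega
      have hzx : z ≠ x := by rintro rfl; simp at hz; omega
      obtain ⟨z', hadj, hd, hp'⟩ := key z hzx hpz
      have h1 := ih (n - 1) (by omega) z' (by omega) hp'
      rcases hT.dist_eq_dist_add_one_of_adj o hadj with h2 | h2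
      · omega
      · -- then `z` would be the parent of `z'`
        exfalso
        by_cases hz'x : z' = x
        · subst hz'x
          rw [eq_parent hT hadj.symm h2] at hpz
          simp at hpz
        · obtain ⟨z'', hadj', hd', hp''⟩ := key z' hz'x hp'
          have h3 := ih (n - 2) (by simp at *; omega) z'' (by omega) hp''
          have h4 := eq_of_adj_of_dist_eq_succ hT hadj.symm h2 hadj' (by omega)
          subst h4
          omega

/-- A vertex `z ≠ x` which is not farther from the root than `x` is on the same side of the edge
from `x` to its parent as the parent. -/
lemma dist_eq_dist_parent_add_one (hT : T.IsTree) {o x z : V} (hx : x ≠ o) (hzx : z ≠ x)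
    (hz : T.dist o z ≤ T.dist o x) : T.dist x z = T.dist (parent T o x) z + 1 := by
  rcases hT.dist_eq_dist_add_one_of_adj z (parent_spec hT hx).1 with h | h
  · rw [SimpleGraph.dist_comm, h, SimpleGraph.dist_comm]
  · exfalso
    have h1 := dist_root_eq_add hT hx _ z rfl
      (by rw [SimpleGraph.dist_comm, h, SimpleGraph.dist_comm])
    have h2 : T.dist x z ≠ 0 := fun h0 => hzx ((hT.connected.dist_eq_zero_iff).1 h0).symm
    omega

/-! ### The Green function of the simple random walk on the regular tree -/

section Green

variable [T.LocallyFinite]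

lemma sum_neighborFinset_dist (hT : T.IsTree) {d : ℕ} (hreg : T.IsRegularOfDegree (d + 1))
    (f : ℕ → ℝ) {x y : V} (hxy : x ≠ y) :
    ∑ z ∈ T.neighborFinset x, f (T.dist y z) =
      f (T.dist y x - 1) + d * f (T.dist y x + 1) := by
  classical
  obtain ⟨hp, hpd⟩ := parent_spec (o := y) hT hxy
  have hmem : parent T y x ∈ T.neighborFinset x := by simpa using hp
  rw [← Finset.add_sum_erase _ _ hmem]
  congr 1
  · rw [hpd]; rfl
  · rw [Finset.sum_congr rfl (g := fun _ => f (T.dist y x + 1))]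
    · rw [Finset.sum_const, Finset.card_erase_of_mem hmem, SimpleGraph.card_neighborFinset_eq_degree,
        hreg x]
      simp
    · intro z hz
      rw [Finset.mem_erase, SimpleGraph.mem_neighborFinset] at hz
      rcases hT.dist_eq_dist_add_one_of_adj y hz.2 with h | h
      · exact absurd (eq_parent hT hz.2 h).symm hz.1
      · rw [h]

lemma sum_neighborFinset_dist_self {d : ℕ} (hreg : T.IsRegularOfDegree (d + 1))
    (f : ℕ → ℝ) (y : V) :
    ∑ z ∈ T.neighborFinset y, f (T.dist y z) = (d + 1) * f 1 := by
  rw [Finset.sum_congr rfl (g := fun _ => f 1)]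
  · rw [Finset.sum_const, SimpleGraph.card_neighborFinset_eq_degree, hreg y]
    simp
  · intro z hz
    rw [SimpleGraph.mem_neighborFinset] at hz
    rw [SimpleGraph.dist_eq_one_iff_adj.2 hz]

lemma stepProb_nonneg (k : ℕ) : ∀ x y : V, 0 ≤ stepProb T k x y := by
  induction k with
  | zero => intro x y; simp only [stepProb]; split_ifs <;> norm_num
  | succ k ih =>
    intro x y
    exact div_nonneg (Finset.sum_nonneg fun z _ => ih z y) (Nat.cast_nonneg _)

/-- The error `d / (d - 1) * d ^ (-dist y x) - ∑ k < n, stepProb T k x y` is harmonically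
propagated in `n`, and `x ↦ (√d) ^ (-dist y x)` is contracted by the walk with the factor
`2 √d / (d + 1) < 1`; hence the error vanishes in the limit. -/
lemma expectedVisits_eq (hT : T.IsTree) {d : ℕ} (hd : 2 ≤ d)
    (hreg : T.IsRegularOfDegree (d + 1)) (x y : V) :
    expectedVisits T x y = d / (d - 1) * ((d : ℝ)⁻¹) ^ (T.dist x y) := by
  classical
  have hd2 : (2 : ℝ) ≤ d := by exact_mod_cast hd
  have hd0 : (0 : ℝ) < d := by linarith
  have hd1 : (0 : ℝ) < d - 1 := by linarith
  set s : ℝ := √d with hs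
  have hs0 : 0 < s := Real.sqrt_pos.2 hd0
  have hss : s * s = d := Real.mul_self_sqrt hd0.le
  have hs1 : 1 < s := by
    rw [hs, Real.lt_sqrt (by norm_num)]; linarith
  set c : ℝ := d / (d - 1) with hc
  have hc0 : 0 < c := div_pos hd0 hd1
  set ρ : ℝ := 2 * s / (d + 1) with hρ
  have hρ0 : 0 ≤ ρ := by positivity
  have hρ1 : ρ < 1 := by
    rw [hρ, div_lt_one (by positivity)]
    nlinarith [mul_pos (sub_pos.2 hs1) (sub_pos.2 hs1)]
  let H : V → ℝ := fun x => c * ((d : ℝ)⁻¹) ^ (T.dist y x)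
  let R : ℕ → V → ℝ := fun n x => H x - ∑ k ∈ Finset.range n, stepProb T k x y
  have hdeg : ∀ x, (T.degree x : ℝ) = d + 1 := fun x => by rw [hreg x]; push_cast; rfl
  have hH : ∀ x, H x = stepProb T 0 x y + (∑ z ∈ T.neighborFinset x, H z) / (T.degree x) := by
    intro x
    rw [hdeg]
    by_cases hxy : x = y
    · subst hxy
      have := sum_neighborFinset_dist_self hreg (fun n => c * ((d : ℝ)⁻¹) ^ n) x
      simp only [H, this, stepProb]
      simp only [SimpleGraph.dist_self, hc]
      field_simp
      simp
    · have := sum_neighborFinset_dist hT hreg (fun n => c * ((d : ℝ)⁻¹) ^ n) hxy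
      obtain ⟨_, hpd⟩ := parent_spec (o := y) hT hxy
      simp only [H, this, stepProb, if_neg hxy]
      rw [hpd, Nat.add_sub_cancel, pow_succ, pow_succ, pow_succ]
      field_simp
      ring
  have hR : ∀ n x, R (n + 1) x = (∑ z ∈ T.neighborFinset x, R n z) / (T.degree x) := by
    intro n x
    simp only [R]
    rw [Finset.sum_range_succ', Finset.sum_sub_distrib, hH x, Finset.sum_comm, sub_div,
      Finset.sum_div]
    simp only [stepProb]
    rw [← Finset.sum_div, ← Finset.sum_div]
    ring
  have hbound : ∀ n x, 0 ≤ R n x ∧ R n x ≤ c * ρ ^ n * (s⁻¹) ^ (T.dist y x) := by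
    intro n
    induction n with
    | zero =>
      intro x
      simp only [R, H, Finset.range_zero, Finset.sum_empty, sub_zero, pow_zero, mul_one]
      refine ⟨by positivity, ?_⟩
      gcongr
      nlinarith
    | succ n ih =>
      intro x
      rw [hR]
      refine ⟨div_nonneg (Finset.sum_nonneg fun z _ => (ih z).1) (Nat.cast_nonneg _), ?_⟩
      rw [hdeg, div_le_iff₀ (by positivity)]
      refine (Finset.sum_le_sum fun z _ => (ih z).2).trans ?_
      have hρe : ρ * (d + 1) = 2 * s := by rw [hρ]; field_simp
      by_cases hxy : x = y
      · subst hxy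
        rw [sum_neighborFinset_dist_self hreg (fun m => c * ρ ^ n * (s⁻¹) ^ m) x]
        simp only [SimpleGraph.dist_self, pow_zero, pow_one, mul_one]
        have h1 : (d + 1) * s⁻¹ ≤ ρ * (d + 1) := by
          rw [hρe, ← div_eq_mul_inv, div_le_iff₀ hs0]
          nlinarith
        calc (d + 1) * (c * ρ ^ n * s⁻¹) = c * ρ ^ n * ((d + 1) * s⁻¹) := by ring
          _ ≤ c * ρ ^ n * (ρ * (d + 1)) := by gcongr
          _ = _ := by ring
      · rw [sum_neighborFinset_dist hT hreg (fun m => c * ρ ^ n * (s⁻¹) ^ m) hxy]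
        obtain ⟨_, hpd⟩ := parent_spec (o := y) hT hxy
        rw [hpd, Nat.add_sub_cancel]
        generalize T.dist y (parent T y x) = m
        have h1 : (d : ℝ) * (s⁻¹ * s⁻¹) = 1 := by
          rw [← hss]; field_simp
        have h2 : s * s⁻¹ = 1 := mul_inv_cancel₀ hs0.ne'
        apply le_of_eq
        calc c * ρ ^ n * s⁻¹ ^ m + d * (c * ρ ^ n * s⁻¹ ^ (m + 1 + 1))
            = c * ρ ^ n * s⁻¹ ^ m * (1 + d * (s⁻¹ * s⁻¹)) := by ring
          _ = c * ρ ^ n * s⁻¹ ^ m * (2 * (s * s⁻¹)) := by rw [h1, h2]; norm_num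
          _ = c * ρ ^ n * s⁻¹ ^ (m + 1) * (2 * s) := by ring
          _ = _ := by rw [← hρe]; ring
  have hlim : Filter.Tendsto (fun n => R n x) Filter.atTop (nhds 0) := by
    have h1 : Filter.Tendsto (fun n => c * ρ ^ n * (s⁻¹) ^ (T.dist y x)) Filter.atTop
        (nhds (c * 0 * (s⁻¹) ^ (T.dist y x))) :=
      ((tendsto_pow_atTop_nhds_zero_of_lt_one hρ0 hρ1).const_mul c).mul_const _
    rw [mul_zero, zero_mul] at h1
    exact squeeze_zero (fun n => (hbound n x).1) (fun n => (hbound n x).2) h1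
  have hsum : HasSum (fun k => stepProb T k x y) (H x) := by
    rw [hasSum_iff_tendsto_nat_of_nonneg (fun k => stepProb_nonneg k x y)]
    have := hlim.const_sub (H x)
    simpa [R] using this
  rw [expectedVisits, hsum.tsum_eq, SimpleGraph.dist_comm]

end Green

end Tree

/-! ### The survival recursion -/

section Survival

/-- The mean of `f` at a child of a vertex with value `b`, when the innovations have law `γ`. -/
noncomputable def childMean (d : ℕ) (γ : Measure ℝ) (f : ℝ → ℝ) (b : ℝ) : ℝ :=
  ∫ y, f ((1 / (d : ℝ)) * b + y) ∂γ

/-- The probability that a vertex with value `b` and `d` children in each generation has a line of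
descent of length `n` along which the field stays above `h`. -/
noncomputable def surv (d : ℕ) (γ : Measure ℝ) (h : ℝ) : ℕ → ℝ → ℝ
  | 0 => fun b => if h ≤ b then 1 else 0
  | n + 1 => fun b => if h ≤ b then 1 - (1 - childMean d γ (surv d γ h n) b) ^ d else 0

/-- The limit of the decreasing sequence `surv d γ h n`, written as an infimum: the probability of an infinite line of descent. -/
noncomputable def survLim (d : ℕ) (γ : Measure ℝ) (h b : ℝ) : ℝ := ⨅ n, surv d γ h n b

lemma one_sub_pow_mono {p q : ℝ} (hpq : p ≤ q) (hq : q ≤ 1) (d : ℕ) :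
    1 - (1 - p) ^ d ≤ 1 - (1 - q) ^ d := by
  have : 0 ≤ 1 - q := by linarith
  gcongr

lemma div_one_add_le_one_sub_pow {q : ℝ} (h0 : 0 ≤ q) (h1 : q ≤ 1) (d : ℕ) :
    d * q / (1 + d * q) ≤ 1 - (1 - q) ^ d := by
  have hb : 1 + d * q ≤ (1 + q) ^ d := one_add_mul_le_pow (by linarith) d
  have hpos : 0 < 1 + d * q := by positivity
  have h2 : (1 - q) ^ d * (1 + q) ^ d ≤ 1 := by
    rw [← mul_pow]
    exact pow_le_one₀ (by nlinarith) (by nlinarith)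
  have h3 : (1 - q) ^ d * (1 + d * q) ≤ 1 :=
    (mul_le_mul_of_nonneg_left hb (pow_nonneg (by linarith) d)).trans h2
  rw [div_le_iff₀ hpos]
  nlinarith

/-- The mean number of successes among `d` trials exceeds the probability of at least one success
by at least the probability `p ^ 2` that two given trials succeed. -/
lemma one_sub_pow_le_sub_sq {p : ℝ} (h1 : p ≤ 1) {d : ℕ} (hd : 2 ≤ d) :
    1 - (1 - p) ^ d ≤ d * p - p ^ 2 := by
  induction d, hd using Nat.le_induction with
  | base => push_cast; nlinarith
  | succ n hn ih =>
    have hn' : (2 : ℝ) ≤ n := by exact_mod_cast hn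
    have h2 : (1 - n * p + p ^ 2) * (1 - p) ≤ (1 - p) ^ n * (1 - p) :=
      mul_le_mul_of_nonneg_right (by linarith) (by linarith)
    have h3 : p * p ^ 2 ≤ n * p ^ 2 :=
      mul_le_mul_of_nonneg_right (by linarith) (by positivity)
    rw [pow_succ]
    push_cast
    nlinarith

variable {d : ℕ} {γ : Measure ℝ} [IsProbabilityMeasure γ] {h : ℝ}

lemma integrable_of_mem_unit {f : ℝ → ℝ} (hf : Measurable f) (hf01 : ∀ x, f x ∈ Set.Icc 0 1) :
    Integrable f γ :=
  Integrable.of_bound hf.aestronglyMeasurable 1 (Filter.Eventually.of_forall fun x => by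
    rw [Real.norm_eq_abs, abs_of_nonneg (hf01 x).1]; exact (hf01 x).2)

lemma integrable_child {f : ℝ → ℝ} (hf : Measurable f) (hf01 : ∀ x, f x ∈ Set.Icc 0 1) (b : ℝ) :
    Integrable (fun y => f ((1 / (d : ℝ)) * b + y)) γ :=
  integrable_of_mem_unit (hf.comp (measurable_const_add _)) fun _ => hf01 _

lemma childMean_mono {f g : ℝ → ℝ} (hf : Measurable f) (hf01 : ∀ x, f x ∈ Set.Icc 0 1)
    (hg : Measurable g) (hg01 : ∀ x, g x ∈ Set.Icc 0 1) (hfg : ∀ x, f x ≤ g x) (b : ℝ) :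
    childMean d γ f b ≤ childMean d γ g b :=
  integral_mono (integrable_child hf hf01 b) (integrable_child hg hg01 b) fun _ => hfg _

lemma childMean_mem {f : ℝ → ℝ} (hf : Measurable f) (hf01 : ∀ x, f x ∈ Set.Icc 0 1) (b : ℝ) :
    childMean d γ f b ∈ Set.Icc 0 1 := by
  refine ⟨integral_nonneg fun _ => (hf01 _).1, ?_⟩
  have := childMean_mono (d := d) (γ := γ) hf hf01 measurable_const
    (fun _ => ⟨zero_le_one, le_refl 1⟩) (fun x => (hf01 x).2) b
  simpa [childMean] using this

lemma measurable_childMean {f : ℝ → ℝ} (hf : Measurable f) :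
    Measurable (childMean d γ f) := by
  have : Measurable (Function.uncurry fun b y : ℝ => f ((1 / (d : ℝ)) * b + y)) :=
    hf.comp (by fun_prop)
  exact this.stronglyMeasurable.integral_prod_right.measurable

lemma monotone_childMean {f : ℝ → ℝ} (hf : Measurable f) (hf01 : ∀ x, f x ∈ Set.Icc 0 1)
    (hm : Monotone f) : Monotone (childMean d γ f) := fun b b' hb =>
  integral_mono (integrable_child hf hf01 b) (integrable_child hf hf01 b') fun y =>
    hm (by gcongr)

lemma surv_regular (d : ℕ) (γ : Measure ℝ) [IsProbabilityMeasure γ] (h : ℝ) (n : ℕ) :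
    Measurable (surv d γ h n) ∧ (∀ b, surv d γ h n b ∈ Set.Icc 0 1) ∧ Monotone (surv d γ h n) := by
  induction n with
  | zero =>
    refine ⟨Measurable.ite measurableSet_Ici measurable_const measurable_const, fun b => ?_,
      fun b b' hb => ?_⟩
    · simp only [surv]; split_ifs <;> simp
    · simp only [surv]
      split_ifs with h1 h2
      · exact le_rfl
      · exact absurd (h1.trans hb) h2
      · exact zero_le_one
      · exact le_rfl
  | succ n ih =>
    obtain ⟨ih1, ih2, ih3⟩ := ih
    have hA : ∀ b, childMean d γ (surv d γ h n) b ∈ Set.Icc 0 1 := childMean_mem ih1 ih2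
    have hF : ∀ b, 1 - (1 - childMean d γ (surv d γ h n) b) ^ d ∈ Set.Icc (0 : ℝ) 1 := fun b =>
      ⟨sub_nonneg.2 (pow_le_one₀ (by linarith [(hA b).2]) (by linarith [(hA b).1])),
        sub_le_self _ (pow_nonneg (by linarith [(hA b).2]) _)⟩
    refine ⟨Measurable.ite measurableSet_Ici
      (((measurable_childMean ih1).const_sub 1).pow_const d |>.const_sub 1) measurable_const,
      fun b => ?_, fun b b' hb => ?_⟩
    · simp only [surv]
      split_ifs
      · exact hF b
      · simp
    · simp only [surv]
      split_ifs with h1 h2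
      · have := monotone_childMean (d := d) (γ := γ) ih1 ih2 ih3 hb
        have h3 := (hA b').2
        exact one_sub_pow_mono this h3 d
      · exact absurd (h1.trans hb) h2
      · exact (hF b').1
      · exact le_rfl

lemma measurable_surv (n : ℕ) : Measurable (surv d γ h n) := (surv_regular d γ h n).1

lemma surv_mem (n : ℕ) (b : ℝ) : surv d γ h n b ∈ Set.Icc 0 1 := (surv_regular d γ h n).2.1 b

lemma monotone_surv (n : ℕ) : Monotone (surv d γ h n) := (surv_regular d γ h n).2.2

lemma surv_succ_le (n : ℕ) : ∀ b, surv d γ h (n + 1) b ≤ surv d γ h n b := by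
  induction n with
  | zero =>
    intro b
    by_cases hb : h ≤ b
    · simpa [surv, hb] using (surv_mem (d := d) (γ := γ) (h := h) 1 b).2
    · simp [surv, hb]
  | succ n ih =>
    intro b
    by_cases hb : h ≤ b
    · simp only [surv, if_pos hb]
      exact one_sub_pow_mono
        (childMean_mono (measurable_surv (n + 1)) (surv_mem (n + 1)) (measurable_surv n)
          (surv_mem n) ih b)
        (childMean_mem (measurable_surv n) (surv_mem n) b).2 d
    · simp [surv, hb]

lemma tendsto_surv (b : ℝ) :
    Filter.Tendsto (fun n => surv d γ h n b) Filter.atTop (nhds (survLim d γ h b)) :=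
  tendsto_atTop_ciInf (antitone_nat_of_succ_le fun n => surv_succ_le n b)
    ⟨0, by rintro _ ⟨n, rfl⟩; exact (surv_mem n b).1⟩

lemma survLim_mem (b : ℝ) : survLim d γ h b ∈ Set.Icc 0 1 :=
  isClosed_Icc.mem_of_tendsto (tendsto_surv b) (Filter.Eventually.of_forall fun n => surv_mem n b)

lemma measurable_survLim : Measurable (survLim d γ h) :=
  measurable_of_tendsto_metrizable (fun n => measurable_surv n)
    (tendsto_pi_nhds.2 fun b => tendsto_surv b)

lemma monotone_survLim : Monotone (survLim d γ h) := fun b b' hb =>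
  le_of_tendsto_of_tendsto' (tendsto_surv b) (tendsto_surv b') fun n => monotone_surv n hb

lemma survLim_eq_zero {b : ℝ} (hb : b < h) : survLim d γ h b = 0 :=
  tendsto_nhds_unique (tendsto_surv b) (by
    have : (fun n => surv d γ h n b) = fun _ => 0 := by
      funext n
      cases n <;> simp [surv, not_le.2 hb]
    rw [this]
    exact tendsto_const_nhds)

lemma tendsto_childMean_surv (b : ℝ) :
    Filter.Tendsto (fun n => childMean d γ (surv d γ h n) b) Filter.atTop
      (nhds (childMean d γ (survLim d γ h) b)) := by
  refine tendsto_integral_of_dominated_convergence (fun _ => 1)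
    (fun n => ((measurable_surv n).comp (measurable_const_add _)).aestronglyMeasurable)
    (integrable_const 1) (fun n => Filter.Eventually.of_forall fun y => ?_)
    (Filter.Eventually.of_forall fun y => tendsto_surv _)
  rw [Real.norm_eq_abs, abs_of_nonneg (surv_mem n _).1]
  exact (surv_mem n _).2

/-- The limiting survival probability is a fixed point of the recursion. -/
lemma survLim_eq {b : ℝ} (hb : h ≤ b) :
    survLim d γ h b = 1 - (1 - childMean d γ (survLim d γ h) b) ^ d := by
  have h1 := (tendsto_surv (d := d) (γ := γ) (h := h) b).comp (Filter.tendsto_add_atTop_nat 1)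
  have h2 := (((tendsto_childMean_surv (d := d) (γ := γ) (h := h) b).const_sub 1).pow d).const_sub 1
  refine tendsto_nhds_unique h1 (h2.congr fun n => ?_)
  simp [surv, hb]

/-- A subsolution `v ≤ θ * childMean v` of the linearised recursion whose factor `θ` is below the
number of children `d` forces survival: a small multiple of `v` is a subsolution of the full
recursion. -/
lemma exists_mul_le_survLim {v : ℝ → ℝ} (hv : Measurable v) (hv01 : ∀ x, v x ∈ Set.Icc 0 1)
    (hvh : ∀ b, b < h → v b = 0) {θ : ℝ} (hθ0 : 0 < θ) (hθd : θ < d)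
    (hsub : ∀ b, h ≤ b → v b ≤ θ * childMean d γ v b) :
    ∃ ε > 0, ∀ b, ε * v b ≤ survLim d γ h b := by
  have hd0 : (0 : ℝ) < d := hθ0.trans hθd
  -- this choice gives `θ * (1 + d * ε) ≤ d`
  set ε : ℝ := min 1 (1 / θ - 1 / d) with hε
  have hε0 : 0 < ε := lt_min one_pos (sub_pos.2 (one_div_lt_one_div_of_lt hθ0 hθd))
  have hε1 : ε ≤ 1 := min_le_left _ _
  have hεθ : θ * (1 + d * ε) ≤ d := by
    have h1 : ε ≤ 1 / θ - 1 / d := min_le_right _ _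
    calc θ * (1 + d * ε) ≤ θ * (1 + d * (1 / θ - 1 / d)) := by gcongr
      _ = d := by field_simp; ring
  have hεv : ∀ x, ε * v x ∈ Set.Icc 0 1 := fun x =>
    ⟨mul_nonneg hε0.le (hv01 x).1, mul_le_one₀ hε1 (hv01 x).1 (hv01 x).2⟩
  have key : ∀ n b, ε * v b ≤ surv d γ h n b := by
    intro n
    induction n with
    | zero =>
      intro b
      by_cases hb : h ≤ b
      · simpa [surv, hb] using (hεv b).2
      · simp [surv, hb, hvh b (not_le.1 hb)]
    | succ n ih =>
      intro b
      by_cases hb : h ≤ b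
      · simp only [surv, if_pos hb]
        have h1 := childMean_mono (d := d) (γ := γ) (hv.const_mul ε) hεv (measurable_surv n)
          (surv_mem n) ih b
        have h2 : childMean d γ (fun x => ε * v x) b = ε * childMean d γ v b :=
          integral_const_mul _ _
        have hm := childMean_mem (d := d) (γ := γ) hv hv01 b
        have h3 : ε * childMean d γ v b ∈ Set.Icc 0 1 :=
          ⟨mul_nonneg hε0.le hm.1, mul_le_one₀ hε1 hm.1 hm.2⟩
        rw [h2] at h1
        refine le_trans ?_ (one_sub_pow_mono h1
          (childMean_mem (measurable_surv n) (surv_mem n) b).2 d)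
        refine le_trans ?_ (div_one_add_le_one_sub_pow h3.1 h3.2 d)
        rw [le_div_iff₀ (by have := h3.1; positivity)]
        have h4 : ε * childMean d γ v b ≤ ε := mul_le_of_le_one_right hε0.le hm.2
        have h5 := hsub b hb
        have hv0 := (hv01 b).1
        calc ε * v b * (1 + d * (ε * childMean d γ v b))
            ≤ ε * v b * (1 + d * ε) := by gcongr
          _ ≤ ε * (θ * childMean d γ v b) * (1 + d * ε) := by gcongr
          _ = ε * childMean d γ v b * (θ * (1 + d * ε)) := by ring
          _ ≤ ε * childMean d γ v b * d := mul_le_mul_of_nonneg_left hεθ h3.1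
          _ = _ := by ring
      · simp [surv, hb, hvh b (not_le.1 hb)]
  exact ⟨ε, hε0, fun b => le_ciInf fun n => key n b⟩

end Survival

/-! ### Survival with Gaussian innovations -/

section Gaussian

variable {d : ℕ} {v : ℝ≥0} {h : ℝ}

lemma gaussianReal_Ici_pos (hv : v ≠ 0) (m t : ℝ) : 0 < gaussianReal m v (Set.Ici t) := by
  rw [pos_iff_ne_zero]
  intro h0
  have := gaussianReal_absolutelyContinuous' m hv h0
  simp at this

lemma gaussianReal_real_Ico_le (v : ℝ≥0) (hv : v ≠ 0) :
    ∃ C > 0, ∀ s t : ℝ, s ≤ t → (gaussianReal 0 v).real (Set.Ico s t) ≤ C * (t - s) := by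
  refine ⟨(√(2 * Real.pi * v))⁻¹, by positivity, fun s t hst => ?_⟩
  rw [Measure.real, gaussianReal_apply_eq_integral 0 hv, ENNReal.toReal_ofReal]
  · calc ∫ x in Set.Ico s t, gaussianPDFReal 0 v x
        ≤ ∫ _ in Set.Ico s t, (√(2 * Real.pi * v))⁻¹ := by
          refine setIntegral_mono (integrable_gaussianPDFReal 0 v).integrableOn
            (integrableOn_const (by simp)) fun x => ?_
          rw [gaussianPDFReal]
          refine mul_le_of_le_one_right (by positivity) (Real.exp_le_one_iff.2 ?_)
          exact div_nonpos_of_nonpos_of_nonneg (neg_nonpos.2 (sq_nonneg _)) (by positivity)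
      _ = _ := by simp [Real.volume_real_Ico_of_le hst, mul_comm]
  · exact integral_nonneg fun x => gaussianPDFReal_nonneg 0 v x

/-- Survival is an open condition in the level. If it has positive probability at level `h`, then
the survival probability `s` satisfies `s ≤ (d - p₀) * childMean s`, where `p₀ > 0` is the least
probability that a given child survives; so `s` is a strict subsolution, and it remains one
after a slight increase of the level. -/
lemma exists_gt_survLim_pos (hd : 2 ≤ d) (hv : v ≠ 0) {b₀ : ℝ}
    (hb₀ : 0 < survLim d (gaussianReal 0 v) h b₀) :
    ∃ h' > h, ∃ b, 0 < survLim d (gaussianReal 0 v) h' b := by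
  set γ := gaussianReal 0 v with hγ
  set s := survLim d γ h with hs
  have hd2 : (2 : ℝ) ≤ d := by exact_mod_cast hd
  have hd0 : (0 : ℝ) < d := by linarith
  have hsm : Measurable s := measurable_survLim
  have hs01 : ∀ x, s x ∈ Set.Icc 0 1 := survLim_mem
  set p₀ := childMean d γ s h with hp₀
  have hp1 : p₀ ≤ 1 := (childMean_mem hsm hs01 h).2
  have hp0 : 0 < p₀ := by
    have h1 : ∫ y, (Set.Ici (b₀ - (1 / (d : ℝ)) * h)).indicator (fun _ => s b₀) y ∂γ ≤ p₀ := by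
      refine integral_mono ((integrable_const _).indicator measurableSet_Ici)
        (integrable_child hsm hs01 h) fun y => ?_
      by_cases hy : y ∈ Set.Ici (b₀ - (1 / (d : ℝ)) * h)
      · rw [Set.indicator_of_mem hy]
        refine monotone_survLim ?_
        rw [Set.mem_Ici] at hy
        linarith
      · rw [Set.indicator_of_notMem hy]
        exact (hs01 _).1
    rw [integral_indicator_const _ measurableSet_Ici] at h1
    refine lt_of_lt_of_le ?_ h1
    have h2 : 0 < γ.real (Set.Ici (b₀ - (1 / (d : ℝ)) * h)) :=
      ENNReal.toReal_pos (gaussianReal_Ici_pos hv 0 _).ne' (measure_ne_top _ _)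
    exact mul_pos h2 hb₀
  have hple : ∀ b, h ≤ b → p₀ ≤ childMean d γ s b := fun b hb =>
    monotone_childMean hsm hs01 monotone_survLim hb
  have hsle : ∀ b, h ≤ b → s b ≤ (d - p₀) * childMean d γ s b := by
    intro b hb
    have hm := childMean_mem (d := d) (γ := γ) hsm hs01 b
    have h1 := one_sub_pow_le_sub_sq hm.2 hd
    rw [← survLim_eq hb] at h1
    have h2 := hple b hb
    have h3 : p₀ * childMean d γ s b ≤ childMean d γ s b ^ 2 := by
      rw [sq]; exact mul_le_mul_of_nonneg_right h2 hm.1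
    calc s b ≤ d * childMean d γ s b - childMean d γ s b ^ 2 := h1
      _ ≤ _ := by linarith
  obtain ⟨C, hC0, hC⟩ := gaussianReal_real_Ico_le v hv
  -- raising the level by `δ` costs at most `C * δ = p₀ * p₀ / (2 * d)` in `childMean`
  set δ := p₀ * p₀ / (2 * d * C) with hδ
  have hδ0 : 0 < δ := by positivity
  refine ⟨h + δ, by linarith, max b₀ (h + δ), ?_⟩
  set w : ℝ → ℝ := (Set.Ici (h + δ)).indicator s with hw
  have hwm : Measurable w := hsm.indicator measurableSet_Ici
  have hw01 : ∀ x, w x ∈ Set.Icc 0 1 := by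
    intro x
    rw [hw]
    by_cases hx : x ∈ Set.Ici (h + δ)
    · rw [Set.indicator_of_mem hx]; exact hs01 x
    · rw [Set.indicator_of_notMem hx]; simp
  have hws : ∀ b, childMean d γ s b - C * δ ≤ childMean d γ w b := by
    intro b
    have h1 : childMean d γ s b ≤ ∫ y, (w ((1 / (d : ℝ)) * b + y) +
        (Set.Ico (h - (1 / (d : ℝ)) * b) (h + δ - (1 / (d : ℝ)) * b)).indicator
          (fun _ => (1 : ℝ)) y) ∂γ := by
      refine integral_mono (integrable_child hsm hs01 b) ((integrable_child hwm hw01 b).add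
        ((integrable_const _).indicator measurableSet_Ico)) fun y => ?_
      simp only [hw, Set.indicator_apply, Set.mem_Ici, Set.mem_Ico]
      have h01 := hs01 ((1 / (d : ℝ)) * b + y)
      by_cases h1 : h + δ ≤ (1 / (d : ℝ)) * b + y
      · rw [if_pos h1]
        have : (0 : ℝ) ≤ if h - 1 / (d : ℝ) * b ≤ y ∧ y < h + δ - 1 / (d : ℝ) * b then 1 else 0 := by
          split_ifs <;> norm_num
        linarith
      · rw [if_neg h1]
        by_cases h2 : h ≤ (1 / (d : ℝ)) * b + y
        · rw [if_pos ⟨by linarith, by linarith⟩, zero_add]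
          exact h01.2
        · rw [hs, survLim_eq_zero (not_le.1 h2)]
          split_ifs <;> norm_num
    rw [integral_add (integrable_child hwm hw01 b)
      ((integrable_const _).indicator measurableSet_Ico),
      integral_indicator_const _ measurableSet_Ico] at h1
    have h2 := hC (h - (1 / (d : ℝ)) * b) (h + δ - (1 / (d : ℝ)) * b) (by linarith)
    have h3 : C * (h + δ - (1 / (d : ℝ)) * b - (h - (1 / (d : ℝ)) * b)) = C * δ := by ring
    rw [h3] at h2
    simp only [smul_eq_mul, mul_one] at h1
    simp only [childMean] at h1 ⊢
    linarith
  have hCδ : C * δ = p₀ * (p₀ / (2 * d)) := by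
    rw [hδ]; field_simp
  set κ := 1 - p₀ / (2 * d) with hκ
  have hκ0 : 0 < κ := by
    rw [hκ, sub_pos, div_lt_one (by positivity)]
    linarith
  have hwA : ∀ b, h + δ ≤ b → κ * childMean d γ s b ≤ childMean d γ w b := by
    intro b hb
    have h1 := hws b
    have h2 : p₀ * (p₀ / (2 * d)) ≤ childMean d γ s b * (p₀ / (2 * d)) :=
      mul_le_mul_of_nonneg_right (hple b (by linarith)) (by positivity)
    rw [hκ]
    rw [hCδ] at h1
    linarith
  have hdp : 0 < d - p₀ := by linarith
  obtain ⟨ε, hε0, hε⟩ := exists_mul_le_survLim (d := d) (γ := γ) (h := h + δ) hwm hw01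
    (fun b hb => Set.indicator_of_notMem (by simpa using hb) _) (θ := (d - p₀) / κ)
    (div_pos hdp hκ0)
    (by
      rw [div_lt_iff₀ hκ0, hκ, mul_sub, mul_one]
      have : d * (p₀ / (2 * d)) = p₀ / 2 := by field_simp
      rw [this]
      linarith)
    (fun b hb => by
      have h1 := hwA b hb
      have h2 := hsle b (by linarith)
      have h3 : w b = s b := Set.indicator_of_mem (by simpa using hb) _
      rw [h3, div_mul_eq_mul_div, le_div_iff₀ hκ0]
      calc s b * κ ≤ (d - p₀) * childMean d γ s b * κ := by gcongr
        _ = (d - p₀) * (κ * childMean d γ s b) := by ring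
        _ ≤ _ := by gcongr)
  refine lt_of_lt_of_le (mul_pos hε0 ?_) (hε (max b₀ (h + δ)))
  rw [hw, Set.indicator_of_mem (Set.mem_Ici.2 (le_max_right _ _))]
  exact hb₀.trans_le (monotone_survLim (le_max_left _ _))

/-- At a sufficiently low level more than half of the children stay above the level, so that the
constant `1` is a strict subsolution. -/
lemma exists_survLim_pos (hd : 2 ≤ d) (v : ℝ≥0) :
    ∃ h b, 0 < survLim d (gaussianReal 0 v) h b := by
  set γ := gaussianReal 0 v with hγ
  have hd2 : (2 : ℝ) ≤ d := by exact_mod_cast hd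
  obtain ⟨t, ht⟩ : ∃ t, 2 / 3 < γ.real (Set.Ici t) := by
    have h1 : Filter.Tendsto (fun t => γ.real (Set.Ici t)) Filter.atBot (nhds 1) := by
      have h2 := tendsto_measure_Ici_atBot γ
      rw [measure_univ] at h2
      exact (ENNReal.tendsto_toReal ENNReal.one_ne_top).comp h2
    exact (h1.eventually (lt_mem_nhds (by norm_num))).exists
  set h := 2 * min t 0 with hh
  set w : ℝ → ℝ := (Set.Ici h).indicator (fun _ => 1) with hw
  have hwm : Measurable w := measurable_const.indicator measurableSet_Ici
  have hw01 : ∀ x, w x ∈ Set.Icc 0 1 := by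
    intro x
    rw [hw, Set.indicator_apply]
    split_ifs <;> simp
  have hA : ∀ b, h ≤ b → 2 / 3 ≤ childMean d γ w b := by
    intro b hb
    have h1 : ∫ y, (Set.Ici t).indicator (fun _ => (1 : ℝ)) y ∂γ ≤ childMean d γ w b := by
      refine integral_mono ((integrable_const _).indicator measurableSet_Ici)
        (integrable_child hwm hw01 b) fun y => ?_
      by_cases hy : y ∈ Set.Ici t
      · rw [Set.indicator_of_mem hy, hw, Set.indicator_of_mem]
        rw [Set.mem_Ici] at hy ⊢
        have h2 : (1 / (d : ℝ)) * h ≤ (1 / (d : ℝ)) * b := by gcongr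
        have h3 : (1 / 2 : ℝ) * h ≤ (1 / (d : ℝ)) * h := by
          refine mul_le_mul_of_nonpos_right ?_ ?_
          · gcongr
          · have := min_le_right t 0
            linarith
        have := min_le_left t 0
        linarith
      · rw [Set.indicator_of_notMem hy]
        exact (hw01 _).1
    rw [integral_indicator_const _ measurableSet_Ici, smul_eq_mul, mul_one] at h1
    linarith
  obtain ⟨ε, hε0, hε⟩ := exists_mul_le_survLim (d := d) (γ := γ) (h := h) hwm hw01
    (fun b hb => Set.indicator_of_notMem (by simpa using hb) _) (θ := 3 / 2) (by norm_num)
    (by linarith)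
    (fun b hb => by
      have := hA b hb
      have := (hw01 b).2
      linarith)
  refine ⟨h, h, lt_of_lt_of_le (mul_pos hε0 ?_) (hε h)⟩
  rw [hw, Set.indicator_of_mem (by simp)]
  exact one_pos

/-- At a sufficiently high level there is no survival, since `b ↦ exp b` satisfies
`d * childMean exp ≤ exp / 2` above the level. -/
lemma exists_survLim_eq_zero (hd : 2 ≤ d) (v : ℝ≥0) :
    ∃ h, ∀ b, survLim d (gaussianReal 0 v) h b = 0 := by
  set γ := gaussianReal 0 v with hγ
  have hd2 : (2 : ℝ) ≤ d := by exact_mod_cast hd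
  set h := 2 * Real.log (2 * d) + v with hh
  have hlog : 0 ≤ Real.log (2 * d) := Real.log_nonneg (by linarith)
  have hh0 : 0 ≤ h := by positivity
  have hexp : ∀ b, Integrable (fun y => Real.exp ((1 / (d : ℝ)) * b + y)) γ := by
    intro b
    simp_rw [Real.exp_add]
    have := (integrable_exp_mul_gaussianReal (μ := 0) (v := v) 1)
    simp only [one_mul] at this
    exact this.const_mul _
  have hA : ∀ b, h ≤ b → d * childMean d γ Real.exp b ≤ 1 / 2 * Real.exp b := by
    intro b hb
    have h1 : childMean d γ Real.exp b = Real.exp ((1 / (d : ℝ)) * b) * Real.exp (v / 2) := by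
      simp only [childMean, Real.exp_add]
      rw [integral_const_mul]
      congr 1
      have := congrFun (mgf_id_gaussianReal (μ := 0) (v := v)) 1
      simpa [mgf] using this
    have h2 : 2 * d = Real.exp (Real.log (2 * d)) := (Real.exp_log (by positivity)).symm
    have h3 : 2 * (d * childMean d γ Real.exp b) ≤ Real.exp b := by
      rw [h1, ← mul_assoc, h2, ← Real.exp_add, ← Real.exp_add, Real.exp_le_exp]
      have h4 : (1 / (d : ℝ)) * b ≤ (1 / 2) * b := by
        refine mul_le_mul_of_nonneg_right ?_ (by linarith)
        gcongr
      linarith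
    linarith
  have key : ∀ n b, surv d γ h n b ≤ (1 / 2) ^ n * Real.exp b := by
    intro n
    induction n with
    | zero =>
      intro b
      by_cases hb : h ≤ b
      · simpa [surv, hb] using hh0.trans hb
      · simpa [surv, hb] using (Real.exp_pos b).le
    | succ n ih =>
      intro b
      by_cases hb : h ≤ b
      · have hm := childMean_mem (d := d) (γ := γ) (measurable_surv (d := d) (γ := γ) (h := h) n)
          (surv_mem n) b
        have h1 : surv d γ h (n + 1) b ≤ d * childMean d γ (surv d γ h n) b := by
          simp only [surv, if_pos hb]
          have := one_sub_pow_le_sub_sq hm.2 hd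
          nlinarith [sq_nonneg (childMean d γ (surv d γ h n) b)]
        have h2 : childMean d γ (surv d γ h n) b ≤ (1 / 2) ^ n * childMean d γ Real.exp b := by
          simp only [childMean]
          rw [← integral_const_mul]
          exact integral_mono (integrable_child (measurable_surv n) (surv_mem n) b)
            ((hexp b).const_mul _) fun y => ih _
        calc surv d γ h (n + 1) b ≤ d * ((1 / 2) ^ n * childMean d γ Real.exp b) :=
              h1.trans (by gcongr)
          _ = (1 / 2) ^ n * (d * childMean d γ Real.exp b) := by ring
          _ ≤ (1 / 2) ^ n * (1 / 2 * Real.exp b) :=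
              mul_le_mul_of_nonneg_left (hA b hb) (by positivity)
          _ = _ := by ring
      · simp only [surv, if_neg hb]
        positivity
  refine ⟨h, fun b => tendsto_nhds_unique (tendsto_surv b) ?_⟩
  have h1 : Filter.Tendsto (fun n : ℕ => (1 / 2 : ℝ) ^ n * Real.exp b) Filter.atTop
      (nhds (0 * Real.exp b)) :=
    (tendsto_pow_atTop_nhds_zero_of_lt_one (by norm_num) (by norm_num)).mul_const _
  rw [zero_mul] at h1
  exact squeeze_zero (fun n => (surv_mem n b).1) (fun n => key n b) h1

end Gaussian

/-! ### Independence of disjoint coordinates under product measures -/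

section ProductMeasure

variable {ι : Type*}

lemma measurable_piecewise_prod (S : Set ι) [DecidablePred (· ∈ S)] :
    Measurable (fun p : (ι → ℝ) × (ι → ℝ) => S.piecewise p.1 p.2) := by
  refine measurable_pi_lambda _ fun i => ?_
  by_cases hi : i ∈ S
  · simp only [Set.piecewise_eq_of_mem _ _ _ hi]; fun_prop
  · simp only [Set.piecewise_eq_of_notMem _ _ _ hi]; fun_prop

/-- Resampling the coordinates outside `S` from an independent product measure gives again a
product measure. -/
lemma map_piecewise_infinitePi (μ₁ μ₂ : ι → Measure ℝ) [∀ i, IsProbabilityMeasure (μ₁ i)]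
    [∀ i, IsProbabilityMeasure (μ₂ i)] (S : Set ι) [DecidablePred (· ∈ S)]
    (ν : ι → Measure ℝ) [∀ i, IsProbabilityMeasure (ν i)]
    (h₁ : ∀ i ∈ S, ν i = μ₁ i) (h₂ : ∀ i, i ∉ S → ν i = μ₂ i) :
    ((Measure.infinitePi μ₁).prod (Measure.infinitePi μ₂)).map
      (fun p => S.piecewise p.1 p.2) = Measure.infinitePi ν := by
  refine Measure.eq_infinitePi _ fun s t ht => ?_
  rw [Measure.map_apply (measurable_piecewise_prod S) (MeasurableSet.pi s.countable_toSet fun i _ => ht i)]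
  have : (fun p : (ι → ℝ) × (ι → ℝ) => S.piecewise p.1 p.2) ⁻¹' (Set.pi s t) =
      (Set.pi (s.filter (· ∈ S)) t) ×ˢ (Set.pi (s.filter (· ∉ S)) t) := by
    ext p
    simp only [Set.mem_preimage, Set.mem_pi, Set.mem_prod, Finset.coe_filter, Set.mem_ofPred_eq,
      Finset.mem_coe]
    constructor
    · refine fun h => ⟨fun i hi => ?_, fun i hi => ?_⟩
      · simpa [Set.piecewise_eq_of_mem _ _ _ hi.2] using h i hi.1
      · simpa [Set.piecewise_eq_of_notMem _ _ _ hi.2] using h i hi.1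
    · rintro ⟨h1, h2⟩ i hi
      by_cases hS : i ∈ S
      · simpa [Set.piecewise_eq_of_mem _ _ _ hS] using h1 i ⟨hi, hS⟩
      · simpa [Set.piecewise_eq_of_notMem _ _ _ hS] using h2 i ⟨hi, hS⟩
  rw [this, Measure.prod_prod, Measure.infinitePi_pi _ fun i _ => ht i,
    Measure.infinitePi_pi _ fun i _ => ht i,
    ← Finset.prod_filter_mul_prod_filter_not s (· ∈ S) (fun i => ν i (t i))]
  congr 1
  · exact Finset.prod_congr rfl fun i hi => by rw [h₁ i (Finset.mem_filter.1 hi).2]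
  · exact Finset.prod_congr rfl fun i hi => by rw [h₂ i (Finset.mem_filter.1 hi).2]

lemma infinitePi_real_inter_eq_mul (γ : Measure ℝ) [IsProbabilityMeasure γ] {S : Set ι}
    {E F : (ι → ℝ) → Prop} (hE : DependsOn E S) (hF : DependsOn F Sᶜ)
    (hEm : MeasurableSet {Y | E Y}) (hFm : MeasurableSet {Y | F Y}) :
    (Measure.infinitePi fun _ : ι => γ).real ({Y | E Y} ∩ {Y | F Y}) =
      (Measure.infinitePi fun _ : ι => γ).real {Y | E Y} *
        (Measure.infinitePi fun _ : ι => γ).real {Y | F Y} := by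
  classical
  have h := map_piecewise_infinitePi (fun _ : ι => γ) (fun _ => γ) S (fun _ => γ)
    (fun _ _ => rfl) (fun _ _ => rfl)
  conv_lhs => rw [← h]
  rw [measureReal_def, Measure.map_apply (measurable_piecewise_prod S) (hEm.inter hFm)]
  have : (fun p : (ι → ℝ) × (ι → ℝ) => S.piecewise p.1 p.2) ⁻¹' ({Y | E Y} ∩ {Y | F Y}) =
      {Y | E Y} ×ˢ {Y | F Y} := by
    ext p
    have h1 : E (S.piecewise p.1 p.2) = E p.1 :=
      hE fun i hi => Set.piecewise_eq_of_mem _ _ _ hi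
    have h2 : F (S.piecewise p.1 p.2) = F p.2 :=
      hF fun i hi => Set.piecewise_eq_of_notMem _ _ _ hi
    simp [h1, h2]
  rw [this, Measure.prod_prod, ENNReal.toReal_mul]
  rfl

end ProductMeasure

/-! ### Lines of descent -/

section Branching

variable {V : Type*} (T : SimpleGraph V)

/-- Starting from the value `b` at `x` and with innovations `Y`, there is a line of descent
`x = x₀, x₁, …, xₙ`, with `xᵢ₊₁ ∈ ch xᵢ`, along which the field stays above `h`. -/
def LineAbove (ch : V → Finset V) (d : ℕ) (h : ℝ) : ℕ → V → ℝ → (V → ℝ) → Prop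
  | 0, _, b, _ => h ≤ b
  | n + 1, x, b, Y => h ≤ b ∧ ∃ z ∈ ch x, LineAbove ch d h n z ((1 / (d : ℝ)) * b + Y z) Y

open Classical in
/-- The children of `x` which belong to the set `A`. -/
noncomputable def children [T.LocallyFinite] (o : V) (A : Set V) (x : V) : Finset V :=
  (T.neighborFinset x).filter fun z => T.dist o z = T.dist o x + 1 ∧ z ∈ A

/-- The vertices in the subtree rooted at `x`, including `x` itself. -/
def subtree (o x : V) : Set V :=
  {y | ∃ k, (parent T o)^[k] y = x ∧ T.dist o y = T.dist o x + k}

variable {T} {o : V} {A : Set V} {d : ℕ} {h : ℝ}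

lemma measurableSet_lineAbove (ch : V → Finset V) (n : ℕ) :
    ∀ x, MeasurableSet {p : ℝ × (V → ℝ) | LineAbove ch d h n x p.1 p.2} := by
  induction n with
  | zero => intro x; exact measurableSet_le measurable_const measurable_fst
  | succ n ih =>
    intro x
    have : {p : ℝ × (V → ℝ) | LineAbove ch d h (n + 1) x p.1 p.2} = {p | h ≤ p.1} ∩
        ⋃ z ∈ ch x, (fun p : ℝ × (V → ℝ) => ((1 / (d : ℝ)) * p.1 + p.2 z, p.2)) ⁻¹'
          {p | LineAbove ch d h n z p.1 p.2} := by
      ext p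
      simp [LineAbove]
    rw [this]
    refine (measurableSet_le measurable_const measurable_fst).inter
      (Finset.measurableSet_biUnion _ fun z _ => ?_)
    refine (ih z).preimage ?_
    fun_prop

lemma measurableSet_lineAbove_right (ch : V → Finset V) (n : ℕ) (x : V) (b : ℝ) :
    MeasurableSet {Y | LineAbove ch d h n x b Y} :=
  (measurableSet_lineAbove ch n x).preimage (measurable_const.prodMk measurable_id)

lemma measurableSet_lineAbove_child (ch : V → Finset V) (n : ℕ) (z : V) (b : ℝ) :
    MeasurableSet {Y : V → ℝ | LineAbove ch d h n z ((1 / (d : ℝ)) * b + Y z) Y} :=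
  (measurableSet_lineAbove ch n z).preimage
    (f := fun Y : V → ℝ => ((1 / (d : ℝ)) * b + Y z, Y)) (by fun_prop)

lemma self_mem_subtree (x : V) : x ∈ subtree T o x := ⟨0, rfl, rfl⟩

variable [T.LocallyFinite]

lemma mem_children {x z : V} :
    z ∈ children T o A x ↔ T.Adj x z ∧ T.dist o z = T.dist o x + 1 ∧ z ∈ A := by
  simp [children]

lemma parent_of_mem_children (hT : T.IsTree) {x z : V} (hz : z ∈ children T o A x) :
    parent T o z = x :=
  eq_parent hT (mem_children.1 hz).1.symm (mem_children.1 hz).2.1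

lemma subtree_child_subset (hT : T.IsTree) {x z : V} (hz : z ∈ children T o A x) :
    subtree T o z ⊆ subtree T o x \ {x} := by
  rintro y ⟨k, hk, hd⟩
  have h1 := (mem_children.1 hz).2.1
  refine ⟨⟨k + 1, ?_, by omega⟩, ?_⟩
  · rw [Function.iterate_succ_apply', hk, parent_of_mem_children hT hz]
  · rintro rfl
    omega

lemma disjoint_subtree {x z w : V} (hz : z ∈ children T o A x)
    (hw : w ∈ children T o A x) (hzw : z ≠ w) : subtree T o w ⊆ (subtree T o z)ᶜ := by
  rintro y ⟨k, hk, hd⟩ ⟨l, hl, hd'⟩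
  have h1 := (mem_children.1 hz).2.1
  have h2 := (mem_children.1 hw).2.1
  have : k = l := by omega
  subst this
  exact hzw (hl.symm.trans hk)

lemma dependsOn_lineAbove (hT : T.IsTree) (n : ℕ) : ∀ (x : V) (b : ℝ),
    DependsOn (LineAbove (children T o A) d h n x b) (subtree T o x \ {x}) := by
  induction n with
  | zero => intro x b Y Y' _; rfl
  | succ n ih =>
    intro x b Y Y' hY
    simp only [LineAbove, eq_iff_iff]
    refine and_congr_right fun _ => exists_congr fun z => and_congr_right fun hz => ?_
    have hs := subtree_child_subset hT hz
    rw [hY z (hs (self_mem_subtree z))]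
    exact (ih z _ fun i hi => hY i (hs hi.1)).to_iff

lemma dependsOn_lineAbove_child (hT : T.IsTree) (n : ℕ) (z : V) (b : ℝ) :
    DependsOn (fun Y => LineAbove (children T o A) d h n z ((1 / (d : ℝ)) * b + Y z) Y)
      (subtree T o z) := by
  intro Y Y' hY
  simp only
  rw [hY z (self_mem_subtree z)]
  exact dependsOn_lineAbove hT n z _ fun i hi => hY i hi.1

variable {γ : Measure ℝ} [IsProbabilityMeasure γ]

/-- The value at the child `z` and the innovations in the subtree of `z` are independent. -/
lemma prob_lineAbove_child (hT : T.IsTree) {n : ℕ} {z : V} {f : ℝ → ℝ}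
    (hf : ∀ b, (Measure.infinitePi fun _ : V => γ).real
      {Y | LineAbove (children T o A) d h n z b Y} = f b) (hfm : Measurable f) (b : ℝ) :
    (Measure.infinitePi fun _ : V => γ).real
      {Y | LineAbove (children T o A) d h n z ((1 / (d : ℝ)) * b + Y z) Y} =
      childMean d γ f b := by
  classical
  set μ := Measure.infinitePi fun _ : V => γ with hμ
  have hf0 : ∀ b, 0 ≤ f b := fun b => by rw [← hf b]; exact measureReal_nonneg
  have hpw := map_piecewise_infinitePi (fun _ : V => γ) (fun _ => γ) {z} (fun _ => γ)
    (fun _ _ => rfl) (fun _ _ => rfl)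
  have hm : MeasurableSet {p : (V → ℝ) × (V → ℝ) |
      LineAbove (children T o A) d h n z ((1 / (d : ℝ)) * b + p.1 z) p.2} :=
    (measurableSet_lineAbove (children T o A) n z).preimage
      (f := fun p : (V → ℝ) × (V → ℝ) => ((1 / (d : ℝ)) * b + p.1 z, p.2)) (by fun_prop)
  conv_lhs => rw [hμ, ← hpw]
  rw [measureReal_def, Measure.map_apply (measurable_piecewise_prod _)
    (measurableSet_lineAbove_child _ n z b)]
  have : (fun p : (V → ℝ) × (V → ℝ) => ({z} : Set V).piecewise p.1 p.2) ⁻¹'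
      {Y | LineAbove (children T o A) d h n z ((1 / (d : ℝ)) * b + Y z) Y} =
      {p | LineAbove (children T o A) d h n z ((1 / (d : ℝ)) * b + p.1 z) p.2} := by
    ext p
    simp only [Set.mem_preimage, Set.mem_ofPred_eq]
    rw [Set.piecewise_eq_of_mem _ _ _ (Set.mem_singleton z)]
    exact (dependsOn_lineAbove hT n z _ fun i hi =>
      Set.piecewise_eq_of_notMem _ _ _ hi.2).to_iff
  rw [this, Measure.prod_apply hm]
  have h2 : ∀ Y : V → ℝ, μ (Prod.mk Y ⁻¹' {p : (V → ℝ) × (V → ℝ) |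
      LineAbove (children T o A) d h n z ((1 / (d : ℝ)) * b + p.1 z) p.2}) =
      ENNReal.ofReal (f ((1 / (d : ℝ)) * b + Y z)) := by
    intro Y
    rw [← hf, ofReal_measureReal]
    rfl
  simp_rw [← hμ, h2]
  have h3 : Measurable fun y => ENNReal.ofReal (f ((1 / (d : ℝ)) * b + y)) :=
    (hfm.comp (measurable_const_add _)).ennreal_ofReal
  rw [childMean, integral_eq_lintegral_of_nonneg_ae (Filter.Eventually.of_forall fun y => hf0 _)
    (hfm.comp (measurable_const_add _)).aestronglyMeasurable]
  congr 1
  rw [← Measure.infinitePi_map_eval (fun _ : V => γ) z, lintegral_map h3 (measurable_pi_apply z)]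

/-- One step of the recursion: the subtrees of the children carry independent innovations. -/
lemma prob_lineAbove_succ (hT : T.IsTree) {n : ℕ} {x : V} {f : ℝ → ℝ}
    (hf : ∀ z ∈ children T o A x, ∀ b, (Measure.infinitePi fun _ : V => γ).real
      {Y | LineAbove (children T o A) d h n z b Y} = f b) (hfm : Measurable f) {b : ℝ}
    (hb : h ≤ b) :
    (Measure.infinitePi fun _ : V => γ).real
      {Y | LineAbove (children T o A) d h (n + 1) x b Y} =
      1 - (1 - childMean d γ f b) ^ (children T o A x).card := by
  classical
  set μ := Measure.infinitePi fun _ : V => γ with hμ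
  let C : V → (V → ℝ) → Prop := fun z Y =>
    LineAbove (children T o A) d h n z ((1 / (d : ℝ)) * b + Y z) Y
  have hCm : ∀ z, MeasurableSet {Y | C z Y} := fun z => measurableSet_lineAbove_child _ n z b
  have hCd : ∀ z, DependsOn (C z) (subtree T o z) := fun z => dependsOn_lineAbove_child hT n z b
  have hIm : ∀ I : Finset V, MeasurableSet {Y | ∀ z ∈ I, ¬ C z Y} := by
    intro I
    have : {Y | ∀ z ∈ I, ¬ C z Y} = ⋂ z ∈ I, {Y | C z Y}ᶜ := by ext; simp
    rw [this]
    exact Finset.measurableSet_biInter _ fun z _ => (hCm z).compl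
  have key : ∀ I : Finset V, I ⊆ children T o A x →
      μ.real {Y | ∀ z ∈ I, ¬ C z Y} = (1 - childMean d γ f b) ^ I.card := by
    intro I
    induction I using Finset.induction_on with
    | empty => intro _; simp
    | insert w I hw ih =>
      intro hsub
      have hwc := hsub (Finset.mem_insert_self w I)
      have h1 : {Y | ∀ z ∈ insert w I, ¬ C z Y} = {Y | ¬ C w Y} ∩ {Y | ∀ z ∈ I, ¬ C z Y} := by
        ext; simp
      rw [h1, infinitePi_real_inter_eq_mul γ (S := subtree T o w), ← hμ,
        ih fun z hz => hsub (Finset.mem_insert_of_mem hz), Finset.card_insert_of_notMem hw, pow_succ',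
        show {Y | ¬ C w Y} = {Y | C w Y}ᶜ from rfl, probReal_compl_eq_one_sub (hCm w),
        prob_lineAbove_child hT (hf w hwc) hfm b]
      · intro Y Y' hY
        simp only
        rw [hCd w hY]
      · intro Y Y' hY
        simp only [eq_iff_iff]
        refine forall_congr' fun z => forall_congr' fun hz => ?_
        have hzc := hsub (Finset.mem_insert_of_mem hz)
        have hne : w ≠ z := fun h => hw (h ▸ hz)
        rw [hCd z fun i hi => hY i (disjoint_subtree hwc hzc hne hi)]
      · exact (hCm w).compl
      · exact hIm I
  have h1 : {Y | LineAbove (children T o A) d h (n + 1) x b Y} =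
      {Y | ∀ z ∈ children T o A x, ¬ C z Y}ᶜ := by
    ext Y
    simp [LineAbove, hb, C]
  rw [h1, probReal_compl_eq_one_sub (hIm _), key _ subset_rfl]

/-- If all vertices of a set closed under taking children have exactly `d` children, then the
lines of descent from these vertices follow the survival recursion. -/
lemma prob_lineAbove_eq_surv (hT : T.IsTree) {S : Set V}
    (hS : ∀ x ∈ S, (children T o A x).card = d ∧ ∀ z ∈ children T o A x, z ∈ S) (n : ℕ) :
    ∀ x ∈ S, ∀ b, (Measure.infinitePi fun _ : V => γ).real
      {Y | LineAbove (children T o A) d h n x b Y} = surv d γ h n b := by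
  induction n with
  | zero =>
    intro x _ b
    by_cases hb : h ≤ b <;> simp [LineAbove, surv, hb]
  | succ n ih =>
    intro x hx b
    by_cases hb : h ≤ b
    · rw [prob_lineAbove_succ hT (fun z hz => ih z ((hS x hx).2 z hz)) (measurable_surv n) hb,
        (hS x hx).1]
      simp [surv, hb]
    · simp [LineAbove, surv, hb]

end Branching

/-! ### Clusters and lines of descent -/

section Cluster

variable {V : Type*} {T : SimpleGraph V} {o : V} {A : Set V} {d : ℕ} {h : ℝ}

/-- The innovation of the field `φ` at `x`; the root value and the innovations away from the root
determine `φ`. At the root, which is its own parent, the value carries no meaning. -/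
noncomputable def innovation (T : SimpleGraph V) (d : ℕ) (o : V) (φ : V → ℝ) (x : V) : ℝ :=
  φ x - (1 / (d : ℝ)) * φ (parent T o x)

lemma measurable_innovation : Measurable (innovation T d o) := by
  unfold innovation
  fun_prop

lemma exists_path_eq_concat (hT : T.IsTree) {x : V} (hx : x ≠ o) {p : T.Walk o x}
    (hp : p.IsPath) :
    ∃ q : T.Walk o (parent T o x), q.length = T.dist o (parent T o x) ∧
      p.support = q.support ++ [x] := by
  obtain ⟨hadj, hd⟩ := parent_spec (o := o) hT hx
  obtain ⟨q, hq, hql⟩ := hT.connected.exists_path_of_dist o (parent T o x)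
  have hqc : (q.concat hadj.symm).IsPath :=
    SimpleGraph.Walk.isPath_of_length_eq_dist _ (by rw [SimpleGraph.Walk.length_concat, hql, hd])
  refine ⟨q, hql, ?_⟩
  rw [(hT.existsUnique_path o x).unique hp hqc, SimpleGraph.Walk.support_concat]

lemma mem_cluster_iff (hT : T.IsTree) {φ : V → ℝ} {x : V} (hx : x ≠ o) :
    x ∈ cluster T o h φ ↔ h ≤ φ x ∧ parent T o x ∈ cluster T o h φ := by
  classical
  constructor
  · rintro ⟨p, hp⟩
    obtain ⟨q, -, hq⟩ := exists_path_eq_concat hT hx p.bypass_isPath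
    have hp' : ∀ z ∈ p.bypass.support, z ∈ levelSet h φ :=
      fun z hz => hp z (p.support_bypass_subset_support hz)
    rw [hq] at hp'
    exact ⟨hp' x (by simp), q, fun z hz => hp' z (by simp [hz])⟩
  · rintro ⟨hx', q, hq⟩
    refine ⟨q.concat (parent_spec hT hx).1.symm, fun z hz => ?_⟩
    rw [SimpleGraph.Walk.support_concat] at hz
    simp only [List.mem_append, List.mem_singleton] at hz
    rcases hz with hz | rfl
    · exact hq z hz
    · exact hx'

lemma le_of_mem_cluster {φ : V → ℝ} {x : V} (hx : x ∈ cluster T o h φ) : h ≤ φ x := by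
  obtain ⟨p, hp⟩ := hx
  exact hp x p.end_mem_support

lemma root_mem_cluster {φ : V → ℝ} (ho : h ≤ φ o) : o ∈ cluster T o h φ :=
  ⟨SimpleGraph.Walk.nil, fun z hz => by
    rw [SimpleGraph.Walk.support_nil, List.mem_singleton] at hz
    subst hz
    exact ho⟩

lemma le_root_of_mem_cluster {φ : V → ℝ} {x : V} (hx : x ∈ cluster T o h φ) : h ≤ φ o := by
  obtain ⟨p, hp⟩ := hx
  exact hp o p.start_mem_support

lemma cluster_anti {h h' : ℝ} (hh : h ≤ h') (φ : V → ℝ) :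
    cluster T o h' φ ⊆ cluster T o h φ := fun _ ⟨p, hp⟩ =>
  ⟨p, fun z hz => hh.trans (hp z hz)⟩

lemma dist_parent_iterate (hT : T.IsTree) (k : ℕ) : ∀ x, k ≤ T.dist o x →
    T.dist o x = T.dist o ((parent T o)^[k] x) + k := by
  induction k with
  | zero => intro x _; rfl
  | succ k ih =>
    intro x hx
    have hxo : x ≠ o := by rintro rfl; simp at hx
    have h1 := (parent_spec hT hxo).2
    rw [Function.iterate_succ_apply]
    have := ih (parent T o x) (by omega)
    omega

lemma parent_iterate_mem {C : Set V}
    (hC : ∀ x ∈ C, x ≠ o → parent T o x ∈ C) (k : ℕ) : ∀ x ∈ C, (parent T o)^[k] x ∈ C := by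
  induction k with
  | zero => intro x hx; exact hx
  | succ k ih =>
    intro x hx
    rw [Function.iterate_succ_apply]
    by_cases hxo : x = o
    · subst hxo
      rw [parent_self]
      exact ih _ hx
    · exact ih _ (hC x hx hxo)

lemma field_root (a : ℝ) (Y : V → ℝ) : field T d o a Y o = a := by
  simp [field, fieldAux]

lemma innovation_field (hT : T.IsTree) (a : ℝ) (Y : V → ℝ) {x : V} (hx : x ≠ o) :
    innovation T d o (field T d o a Y) x = Y x := by
  have h1 : field T d o a Y x =
      (1 / (d : ℝ)) * field T d o a Y (parent T o x) + Y x := by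
    conv_lhs => rw [field, (parent_spec hT hx).2]
    rfl
  rw [innovation, h1]
  ring

lemma root_mem_forwardTree {obar : V} (ho : T.Adj o obar) : o ∈ forwardTree T o obar := by
  intro p hp
  rw [SimpleGraph.dist_self, SimpleGraph.Walk.length_eq_zero_iff] at hp
  rw [SimpleGraph.Walk.nil_iff_support_eq.1 hp, List.mem_singleton]
  exact ho.ne.symm

lemma mem_forwardTree_iff (hT : T.IsTree) {obar x : V} (hx : x ≠ o) :
    x ∈ forwardTree T o obar ↔ x ≠ obar ∧ parent T o x ∈ forwardTree T o obar := by
  constructor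
  · intro hmem
    refine ⟨?_, fun q hq hqmem => ?_⟩
    · rintro rfl
      obtain ⟨p, hp⟩ := hT.connected.exists_walk_length_eq_dist o x
      exact hmem p hp p.end_mem_support
    · refine hmem (q.concat (parent_spec hT hx).1.symm) ?_ ?_
      · rw [SimpleGraph.Walk.length_concat, hq, (parent_spec hT hx).2]
      · rw [SimpleGraph.Walk.support_concat]
        simp [hqmem]
  · rintro ⟨hne, hmem⟩ p hp hpmem
    obtain ⟨q, hq, hqs⟩ := exists_path_eq_concat hT hx (p.isPath_of_length_eq_dist hp)
    rw [hqs, List.mem_append, List.mem_singleton] at hpmem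
    rcases hpmem with h1 | h1
    · exact hmem q hq h1
    · exact hne h1.symm

lemma etaPlus_le_eta {obar : V} (κ : ℝ≥0) (h a : ℝ) : etaPlus T d κ o obar h a ≤ eta T d κ o h a :=
  measureReal_mono fun _ hφ => hφ.mono Set.inter_subset_left

variable [T.LocallyFinite]

lemma finite_dist_le (hT : T.IsTree) (o : V) (n : ℕ) : {x | T.dist o x ≤ n}.Finite := by
  induction n with
  | zero =>
    refine (Set.finite_singleton o).subset fun x hx => ?_
    exact ((hT.connected.dist_eq_zero_iff).1 (Nat.le_zero.1 hx)).symm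
  | succ n ih =>
    refine (ih.union (ih.biUnion fun x _ => (T.neighborFinset x).finite_toSet)).subset
      fun x hx => ?_
    by_cases hxo : x = o
    · subst hxo
      left
      simp
    · right
      obtain ⟨hadj, hd⟩ := parent_spec (o := o) hT hxo
      have hx' : T.dist o x ≤ n + 1 := hx
      simp only [Set.mem_iUnion]
      refine ⟨parent T o x, ?_, ?_⟩
      · change T.dist o (parent T o x) ≤ n
        omega
      · simpa using hadj.symm

/-- An infinite set of vertices which is closed under taking parents meets every generation, and
conversely. -/
lemma infinite_iff_forall_exists_dist_eq (hT : T.IsTree) {C : Set V}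
    (hC : ∀ x ∈ C, x ≠ o → parent T o x ∈ C) :
    C.Infinite ↔ ∀ n, ∃ y ∈ C, T.dist o y = n := by
  constructor
  · intro hinf n
    obtain ⟨x, hx, hxn⟩ : ∃ x ∈ C, n ≤ T.dist o x := by
      by_contra! hcon
      exact hinf ((finite_dist_le hT o n).subset fun x hx => (hcon x hx).le)
    have := dist_parent_iterate (o := o) hT (T.dist o x - n) x (by omega)
    exact ⟨_, parent_iterate_mem hC (T.dist o x - n) x hx, by omega⟩
  · intro hall hfin
    obtain ⟨N, hN⟩ := (hfin.image (T.dist o)).bddAbove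
    obtain ⟨y, hy, hyn⟩ := hall (N + 1)
    have := hN (Set.mem_image_of_mem _ hy)
    omega

lemma lineAbove_iff_exists_mem (hT : T.IsTree) (hA : ∀ x ∈ A, x ≠ o → parent T o x ∈ A)
    (φ : V → ℝ) (n : ℕ) : ∀ x ∈ cluster T o h φ ∩ A,
    (LineAbove (children T o A) d h n x (φ x) (innovation T d o φ) ↔
      ∃ y ∈ cluster T o h φ ∩ A, (parent T o)^[n] y = x ∧ T.dist o y = T.dist o x + n) := by
  have hC : ∀ x ∈ cluster T o h φ ∩ A, x ≠ o → parent T o x ∈ cluster T o h φ ∩ A :=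
    fun x hx hxo => ⟨((mem_cluster_iff hT hxo).1 hx.1).2, hA x hx.2 hxo⟩
  induction n with
  | zero =>
    intro x hx
    exact ⟨fun _ => ⟨x, hx, rfl, rfl⟩, fun _ => le_of_mem_cluster hx.1⟩
  | succ n ih =>
    intro x hx
    have hval : ∀ z ∈ children T o A x,
        (1 / (d : ℝ)) * φ x + innovation T d o φ z = φ z := by
      intro z hz
      rw [innovation, parent_of_mem_children hT hz]
      ring
    have hroot : ∀ z ∈ children T o A x, z ≠ o := by
      rintro z hz rfl
      simpa using (mem_children.1 hz).2.1
    constructor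
    · rintro ⟨-, z, hz, hline⟩
      rw [hval z hz] at hline
      have hzh : h ≤ φ z := by
        cases n with
        | zero => exact hline
        | succ n => exact hline.1
      have hzC : z ∈ cluster T o h φ ∩ A := by
        refine ⟨(mem_cluster_iff hT (hroot z hz)).2 ⟨hzh, ?_⟩, (mem_children.1 hz).2.2⟩
        rw [parent_of_mem_children hT hz]
        exact hx.1
      obtain ⟨y, hy, hyp, hyd⟩ := (ih z hzC).1 hline
      have := (mem_children.1 hz).2.1
      exact ⟨y, hy, by rw [Function.iterate_succ_apply', hyp, parent_of_mem_children hT hz],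
        by omega⟩
    · rintro ⟨y, hy, hyp, hyd⟩
      rw [Function.iterate_succ_apply'] at hyp
      set z := (parent T o)^[n] y with hz
      have hzC : z ∈ cluster T o h φ ∩ A := parent_iterate_mem hC n y hy
      have hzd := dist_parent_iterate (o := o) hT n y (by omega)
      rw [← hz] at hzd
      have hzo : z ≠ o := by
        intro h0
        rw [h0, SimpleGraph.dist_self] at hzd
        omega
      have hzc : z ∈ children T o A x := by
        have := (parent_spec hT hzo).1.symm
        rw [hyp] at this
        exact mem_children.2 ⟨this, by omega, hzC.2⟩
      refine ⟨le_of_mem_cluster hx.1, z, hzc, ?_⟩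
      rw [hval z hzc]
      exact (ih z hzC).2 ⟨y, hy, rfl, hzd⟩

/-- With `A` the whole tree or the forward tree, percolation amounts to lines of descent of every
length. -/
lemma cluster_inter_infinite_iff (hT : T.IsTree) (hA : ∀ x ∈ A, x ≠ o → parent T o x ∈ A)
    (hoA : o ∈ A) (φ : V → ℝ) :
    (cluster T o h φ ∩ A).Infinite ↔
      ∀ n, LineAbove (children T o A) d h n o (φ o) (innovation T d o φ) := by
  have hC : ∀ x ∈ cluster T o h φ ∩ A, x ≠ o → parent T o x ∈ cluster T o h φ ∩ A :=
    fun x hx hxo => ⟨((mem_cluster_iff hT hxo).1 hx.1).2, hA x hx.2 hxo⟩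
  rw [infinite_iff_forall_exists_dist_eq (o := o) hT hC]
  refine forall_congr' fun n => ?_
  by_cases ho : h ≤ φ o
  · rw [lineAbove_iff_exists_mem hT hA φ n o ⟨root_mem_cluster ho, hoA⟩]
    refine exists_congr fun y => and_congr_right fun _ => ?_
    rw [SimpleGraph.dist_self, zero_add]
    refine ⟨fun hyn => ⟨?_, hyn⟩, fun hyn => hyn.2⟩
    have := dist_parent_iterate (o := o) hT n y hyn.ge
    exact ((hT.connected.dist_eq_zero_iff).1 (by omega)).symm
  · constructor
    · rintro ⟨y, hy, -⟩
      exact absurd (le_root_of_mem_cluster hy.1) ho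
    · intro hline
      refine absurd ?_ ho
      cases n with
      | zero => exact hline
      | succ n => exact hline.1

lemma measurableSet_cluster_inter_infinite (hT : T.IsTree)
    (hA : ∀ x ∈ A, x ≠ o → parent T o x ∈ A) (hoA : o ∈ A) :
    MeasurableSet {φ : V → ℝ | (cluster T o h φ ∩ A).Infinite} := by
  -- any normalisation of the innovations describes the event; `1` is as good as `d`
  have : {φ : V → ℝ | (cluster T o h φ ∩ A).Infinite} =
      ⋂ n, (fun φ : V → ℝ => (φ o, innovation T 1 o φ)) ⁻¹'
        {p | LineAbove (children T o A) 1 h n o p.1 p.2} := by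
    ext φ
    simp only [Set.mem_ofPred_eq, Set.mem_iInter, Set.mem_preimage]
    exact cluster_inter_infinite_iff hT hA hoA φ
  rw [this]
  exact MeasurableSet.iInter fun n => (measurableSet_lineAbove _ n o).preimage
    ((measurable_pi_apply o).prodMk measurable_innovation)

/-- The law of the innovations `Y x` in the definition of `condLaw`. -/
noncomputable abbrev innovationLaw (d : ℕ) (κ : ℝ≥0) : Measure ℝ :=
  gaussianReal 0 (κ * ((d : ℝ≥0) + 1) / (d : ℝ≥0))

lemma condLaw_infinite_eq (hT : T.IsTree) (hA : ∀ x ∈ A, x ≠ o → parent T o x ∈ A)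
    (hoA : o ∈ A) (κ : ℝ≥0) (a : ℝ) :
    condLaw T d κ o a {φ | (cluster T o h φ ∩ A).Infinite} =
      Measure.infinitePi (fun _ : V => innovationLaw d κ)
        {Y | ∀ n, LineAbove (children T o A) d h n o a Y} := by
  rw [condLaw, Measure.map_apply (measurable_field T d o a)
    (measurableSet_cluster_inter_infinite hT hA hoA)]
  congr 1
  ext Y
  simp only [Set.mem_preimage, Set.mem_ofPred_eq]
  rw [cluster_inter_infinite_iff (d := d) hT hA hoA, field_root]
  exact forall_congr' fun n => (dependsOn_lineAbove hT n o a fun x hx =>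
    innovation_field hT a Y hx.2).to_iff

lemma lineAbove_of_succ {ch : V → Finset V} (n : ℕ) : ∀ {x : V} {b : ℝ} {Y : V → ℝ},
    LineAbove ch d h (n + 1) x b Y → LineAbove ch d h n x b Y := by
  induction n with
  | zero => exact fun hl => hl.1
  | succ n ih => exact fun ⟨hb, z, hz, hl⟩ => ⟨hb, z, hz, ih hl⟩

lemma tendsto_prob_lineAbove (γ : Measure ℝ) [IsProbabilityMeasure γ] (ch : V → Finset V)
    (x : V) (b : ℝ) :
    Filter.Tendsto (fun n => (Measure.infinitePi fun _ : V => γ).real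
      {Y | LineAbove ch d h n x b Y}) Filter.atTop
      (nhds ((Measure.infinitePi fun _ : V => γ).real {Y | ∀ n, LineAbove ch d h n x b Y})) := by
  have h1 : {Y | ∀ n, LineAbove ch d h n x b Y} = ⋂ n, {Y | LineAbove ch d h n x b Y} := by
    ext; simp
  rw [h1]
  refine (ENNReal.tendsto_toReal (measure_ne_top _ _)).comp ?_
  exact tendsto_measure_iInter_atTop
    (fun n => (measurableSet_lineAbove_right ch n x b).nullMeasurableSet)
    (antitone_nat_of_succ_le fun n Y hY => lineAbove_of_succ n hY) ⟨0, measure_ne_top _ _⟩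

/-! ### The percolation functions -/

section Eta

variable {obar : V}

lemma card_children_of_ne_root (hT : T.IsTree) (hreg : T.IsRegularOfDegree (d + 1)) {x : V}
    (hx : x ≠ o) (hA : ∀ z, T.Adj x z → T.dist o z = T.dist o x + 1 → z ∈ A) :
    (children T o A x).card = d := by
  classical
  obtain ⟨hp, hpd⟩ := parent_spec (o := o) hT hx
  have : children T o A x = (T.neighborFinset x).erase (parent T o x) := by
    ext z
    rw [mem_children, Finset.mem_erase, SimpleGraph.mem_neighborFinset]
    constructor
    · rintro ⟨h1, h2, -⟩
      refine ⟨?_, h1⟩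
      rintro rfl
      omega
    · rintro ⟨h1, h2⟩
      rcases hT.dist_eq_dist_add_one_of_adj o h2 with h3 | h3
      · exact absurd (eq_parent hT h2 h3).symm h1
      · exact ⟨h2, h3, hA z h2 h3⟩
  rw [this, Finset.card_erase_of_mem (by simpa using hp),
    SimpleGraph.card_neighborFinset_eq_degree, hreg x]
  rfl

lemma mem_children_root {z : V} : z ∈ children T o A o ↔ T.Adj o z ∧ z ∈ A := by
  rw [mem_children]
  refine and_congr_right fun hz => ?_
  simp [SimpleGraph.dist_eq_one_iff_adj.2 hz]

lemma card_children_forwardTree (hT : T.IsTree) (hreg : T.IsRegularOfDegree (d + 1))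
    (ho : T.Adj o obar) {x : V} (hx : x ∈ forwardTree T o obar) :
    (children T o (forwardTree T o obar) x).card = d := by
  classical
  by_cases hxo : x = o
  · subst hxo
    have : children T x (forwardTree T x obar) x = (T.neighborFinset x).erase obar := by
      ext z
      rw [mem_children_root, Finset.mem_erase, SimpleGraph.mem_neighborFinset, and_comm]
      refine and_congr_left fun hz => ?_
      rw [mem_forwardTree_iff hT hz.ne.symm, parent_of_adj_root hT hz]
      exact and_iff_left hx
    rw [this, Finset.card_erase_of_mem (by simpa using ho),
      SimpleGraph.card_neighborFinset_eq_degree, hreg x]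
    rfl
  · refine card_children_of_ne_root hT hreg hxo fun z hz hzd => ?_
    have hpz : parent T o z = x := eq_parent hT hz.symm hzd
    refine (mem_forwardTree_iff hT ?_).2 ⟨?_, ?_⟩
    · rintro rfl
      simp at hzd
    · rintro rfl
      exact hxo (hpz.symm.trans (parent_of_adj_root hT ho))
    · rwa [hpz]

lemma etaPlus_eq (hT : T.IsTree) (hreg : T.IsRegularOfDegree (d + 1)) (ho : T.Adj o obar)
    (κ : ℝ≥0) (h a : ℝ) :
    etaPlus T d κ o obar h a = survLim d (innovationLaw d κ) h a := by
  have hoA := root_mem_forwardTree ho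
  rw [etaPlus, measureReal_def, condLaw_infinite_eq hT
    (fun x hx hxo => ((mem_forwardTree_iff hT hxo).1 hx).2) hoA, ← measureReal_def]
  refine tendsto_nhds_unique (tendsto_prob_lineAbove _ _ o a) ?_
  simp_rw [prob_lineAbove_eq_surv (h := h) (γ := innovationLaw d κ) hT
    (S := forwardTree T o obar) (A := forwardTree T o obar)
    (fun x hx => ⟨card_children_forwardTree hT hreg ho hx,
      fun z hz => (mem_children.1 hz).2.2⟩) _ o hoA a]
  exact tendsto_surv a

/-- The root has `d + 1` children in the whole tree, so its survival probability is not
`survLim`; but it vanishes as soon as the subtrees of the children die out. -/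
lemma eta_eq_zero (hT : T.IsTree) (hreg : T.IsRegularOfDegree (d + 1)) (κ : ℝ≥0) {h : ℝ}
    (h0 : ∀ b, survLim d (innovationLaw d κ) h b = 0) (a : ℝ) :
    eta T d κ o h a = 0 := by
  by_cases ha : h ≤ a
  · have h1 := condLaw_infinite_eq (T := T) (o := o) (d := d) (h := h) (A := Set.univ) hT
      (fun _ _ _ => Set.mem_univ _) (Set.mem_univ o) κ a
    simp only [Set.inter_univ] at h1
    rw [eta, measureReal_def, h1, ← measureReal_def]
    have h2 := (tendsto_prob_lineAbove (d := d) (h := h) (innovationLaw d κ)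
      (children T o Set.univ) o a).comp (Filter.tendsto_add_atTop_nat 1)
    refine tendsto_nhds_unique h2 ?_
    have h3 : ∀ n, (Measure.infinitePi fun _ : V => innovationLaw d κ).real
        {Y | LineAbove (children T o Set.univ) d h (n + 1) o a Y} =
        1 - (1 - childMean d (innovationLaw d κ) (surv d (innovationLaw d κ) h n) a) ^
          (children T o Set.univ o).card := by
      intro n
      refine prob_lineAbove_succ hT (fun z hz b => ?_) (measurable_surv n) ha
      have hzS : z ∈ {x | x ≠ o} := (mem_children_root.1 hz).1.ne.symm
      refine prob_lineAbove_eq_surv hT (S := {x | x ≠ o}) (fun x hx =>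
        ⟨card_children_of_ne_root hT hreg hx fun _ _ _ => Set.mem_univ _, fun w hw => ?_⟩)
        n z hzS b
      rintro rfl
      simpa using (mem_children.1 hw).2.1
    have h4 : childMean d (innovationLaw d κ) (survLim d (innovationLaw d κ) h) a = 0 := by
      simp [childMean, h0]
    have h5 := (((tendsto_childMean_surv (d := d) (γ := innovationLaw d κ) (h := h) a).const_sub
      1).pow (children T o Set.univ o).card).const_sub 1
    rw [h4, sub_zero, one_pow, sub_self] at h5
    exact h5.congr fun n => (h3 n).symm
  · have h1 := condLaw_infinite_eq (T := T) (o := o) (d := d) (h := h) (A := Set.univ) hT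
      (fun _ _ _ => Set.mem_univ _) (Set.mem_univ o) κ a
    simp only [Set.inter_univ] at h1
    rw [eta, measureReal_def, h1]
    have : {Y : V → ℝ | ∀ n, LineAbove (children T o Set.univ) d h n o a Y} = ∅ := by
      ext Y
      simp only [Set.mem_ofPred_eq, Set.mem_empty_iff_false, iff_false]
      exact fun hl => ha (hl 0)
    rw [this]
    simp

end Eta

end Cluster

/-! ### The Gaussian free field as a Markov field on the tree -/

section FreeField

variable {V : Type*} {T : SimpleGraph V} {o : V} {d : ℕ} {κ : ℝ≥0}
  {P : Measure (V → ℝ)}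

open Classical in
/-- The root value at the root, and the innovation at every other vertex. -/
noncomputable def rootedInnovation (T : SimpleGraph V) (d : ℕ) (o : V) (x : V) (φ : V → ℝ) : ℝ :=
  φ x - (if x = o then 0 else 1 / (d : ℝ)) * φ (parent T o x)

lemma rootedInnovation_root (φ : V → ℝ) : rootedInnovation T d o o φ = φ o := by
  simp [rootedInnovation]

lemma rootedInnovation_of_ne (φ : V → ℝ) {x : V} (hx : x ≠ o) :
    rootedInnovation T d o x φ = innovation T d o φ x := by
  simp [rootedInnovation, innovation, hx]

lemma measurable_rootedInnovation (x : V) : Measurable (rootedInnovation T d o x) := by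
  unfold rootedInnovation
  fun_prop

lemma subcriticalLevels_upward {h h' : ℝ} (hh : h ≤ h') (hmem : h ∈ subcriticalLevels T o P) :
    h' ∈ subcriticalLevels T o P :=
  measure_mono_null (fun φ hφ => Set.Infinite.mono (cluster_anti hh φ) hφ) hmem

variable [T.LocallyFinite]

/-- The variance of the free field at a vertex; the truncation `toNNReal` has no effect when
`2 ≤ d`. -/
noncomputable def fieldVariance (d : ℕ) (κ : ℝ≥0) : ℝ≥0 :=
  (κ * (d / (d - 1) : ℝ)).toNNReal

lemma coe_fieldVariance (hd : 2 ≤ d) :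
    (fieldVariance d κ : ℝ) = κ * (d / (d - 1)) := by
  have hd2 : (2 : ℝ) ≤ d := by exact_mod_cast hd
  have : (0 : ℝ) ≤ d - 1 := by linarith
  exact Real.coe_toNNReal _ (by positivity)

lemma fieldVariance_ne_zero (hd : 2 ≤ d) (hκ : 0 < κ) : fieldVariance d κ ≠ 0 := by
  have hd2 : (2 : ℝ) ≤ d := by exact_mod_cast hd
  have h1 : (0 : ℝ) < d - 1 := by linarith
  have hκ' : (0 : ℝ) < κ := hκ
  rw [← NNReal.coe_ne_zero, coe_fieldVariance hd]
  positivity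

namespace IsGFF

lemma memLp_two (hP : IsGFF T κ P) (x : V) : MemLp (fun φ : V → ℝ => φ x) 2 P :=
  (hP.gaussian.hasGaussianLaw_eval x).memLp_two

lemma covariance_eval (hT : T.IsTree) (hd : 2 ≤ d) (hreg : T.IsRegularOfDegree (d + 1))
    (hP : IsGFF T κ P) (x y : V) :
    cov[fun φ => φ x, fun φ => φ y; P] = fieldVariance d κ * ((d : ℝ)⁻¹) ^ T.dist x y := by
  have := hP.isProbabilityMeasure
  rw [covariance_eq_sub (hP.memLp_two x) (hP.memLp_two y), hP.centred x, hP.centred y, mul_zero,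
    sub_zero]
  have h1 := hP.covariance x y
  rw [expectedVisits_eq hT hd hreg] at h1
  rw [coe_fieldVariance hd, mul_assoc, ← h1]
  rfl

lemma memLp_two_rootedInnovation (hP : IsGFF T κ P) (x : V) :
    MemLp (rootedInnovation T d o x) 2 P :=
  (hP.memLp_two x).sub ((hP.memLp_two _).const_mul _)

open Classical in
lemma covariance_rootedInnovation_left (hP : IsGFF T κ P) (x : V) {F : (V → ℝ) → ℝ}
    (hF : MemLp F 2 P) :
    cov[rootedInnovation T d o x, F; P] = cov[fun φ => φ x, F; P] -
      (if x = o then 0 else 1 / (d : ℝ)) * cov[fun φ => φ (parent T o x), F; P] := by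
  have := hP.isProbabilityMeasure
  have h := covariance_fun_sub_left (hP.memLp_two x)
    ((hP.memLp_two (parent T o x)).const_mul (if x = o then 0 else 1 / (d : ℝ))) hF
  rw [covariance_const_mul_left] at h
  exact h

/-- The innovation at `x` is uncorrelated with the field outside the subtree of `x`; only the
vertices not farther from the root than `x` are needed. -/
lemma covariance_rootedInnovation_eval (hT : T.IsTree) (hd : 2 ≤ d)
    (hreg : T.IsRegularOfDegree (d + 1)) (hP : IsGFF T κ P) {x z : V} (hx : x ≠ o) (hzx : z ≠ x)
    (hz : T.dist o z ≤ T.dist o x) :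
    cov[rootedInnovation T d o x, fun φ => φ z; P] = 0 := by
  rw [covariance_rootedInnovation_left hP x (hP.memLp_two z), covariance_eval hT hd hreg hP,
    covariance_eval hT hd hreg hP, dist_eq_dist_parent_add_one hT hx hzx hz, if_neg hx, pow_succ]
  ring

lemma covariance_rootedInnovation (hT : T.IsTree) (hd : 2 ≤ d)
    (hreg : T.IsRegularOfDegree (d + 1)) (hP : IsGFF T κ P) {x y : V} (hxy : x ≠ y) :
    cov[rootedInnovation T d o x, rootedInnovation T d o y; P] = 0 := by
  wlog h : T.dist o y ≤ T.dist o x generalizing x y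
  · rw [covariance_comm]
    exact this hxy.symm (by omega)
  have hx : x ≠ o := by
    rintro rfl
    rw [SimpleGraph.dist_self, Nat.le_zero, hT.connected.dist_eq_zero_iff] at h
    exact hxy h
  have hp : parent T o y ≠ x ∧ T.dist o (parent T o y) ≤ T.dist o x := by
    by_cases hy : y = o
    · rw [hy, parent_self]
      exact ⟨hx.symm, by simp⟩
    · have h1 := (parent_spec hT hy).2
      exact ⟨fun h2 => by rw [h2] at h1; omega, by omega⟩
  rw [covariance_comm, covariance_rootedInnovation_left hP y (memLp_two_rootedInnovation hP x),
    covariance_comm, covariance_rootedInnovation_eval hT hd hreg hP hx hxy.symm h,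
    covariance_comm, covariance_rootedInnovation_eval hT hd hreg hP hx hp.1 hp.2]
  simp

open Classical in
lemma variance_rootedInnovation (hT : T.IsTree) (hd : 2 ≤ d)
    (hreg : T.IsRegularOfDegree (d + 1)) (hP : IsGFF T κ P) (x : V) :
    Var[rootedInnovation T d o x; P] =
      (if x = o then fieldVariance d κ else κ * ((d : ℝ≥0) + 1) / (d : ℝ≥0) : ℝ≥0) := by
  have := hP.isProbabilityMeasure
  have hd2 : (2 : ℝ) ≤ d := by exact_mod_cast hd
  have hd1 : (d : ℝ) - 1 ≠ 0 := by linarith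
  rw [← covariance_self (measurable_rootedInnovation x).aemeasurable]
  have hW := memLp_two_rootedInnovation (d := d) (o := o) hP x
  rw [covariance_rootedInnovation_left hP x hW, covariance_comm,
    covariance_rootedInnovation_left hP x (hP.memLp_two x),
    covariance_comm _ (rootedInnovation T d o x),
    covariance_rootedInnovation_left hP x (hP.memLp_two _)]
  simp only [covariance_eval hT hd hreg hP]
  by_cases hx : x = o
  · simp [hx]
  · have h1 : T.dist x (parent T o x) = 1 :=
      SimpleGraph.dist_eq_one_iff_adj.2 (parent_spec hT hx).1
    rw [if_neg hx, if_neg hx, SimpleGraph.dist_comm (u := parent T o x) (v := x), h1,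
      SimpleGraph.dist_self, SimpleGraph.dist_self, coe_fieldVariance hd]
    push_cast
    field_simp
    ring

open Classical in
/-- Under the law of the free field, the root value and the innovations are independent. -/
lemma map_rootedInnovation (hT : T.IsTree) (hd : 2 ≤ d)
    (hreg : T.IsRegularOfDegree (d + 1)) (hP : IsGFF T κ P) :
    P.map (fun φ x => rootedInnovation T d o x φ) =
      Measure.infinitePi fun x : V => gaussianReal 0
        (if x = o then fieldVariance d κ else κ * ((d : ℝ≥0) + 1) / (d : ℝ≥0)) := by
  have := hP.isProbabilityMeasure
  have hgauss : IsGaussianProcess (fun x => rootedInnovation T d o x) P := by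
    refine hP.gaussian.of_isGaussianProcess fun x => ⟨{x, parent T o x}, ?_⟩
    refine ⟨ContinuousLinearMap.proj ⟨x, by simp⟩ - (if x = o then 0 else 1 / (d : ℝ)) •
      ContinuousLinearMap.proj ⟨parent T o x, by simp⟩, fun φ => ?_⟩
    by_cases hx : x = o <;> simp [rootedInnovation, Finset.restrict_def, hx]
  have hind : iIndepFun (fun x => rootedInnovation T d o x) P := by
    have h1 := IsGaussianProcess.iIndepFun_of_covariance_eq_zero (S := fun _ : V => Unit)
      (X := fun x _ => rootedInnovation T d o x) (P := P)
      (hgauss.comp_right (fun p : (_ : V) × Unit => p.1))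
      (fun x _ => (measurable_rootedInnovation x).aemeasurable)
      (fun x y hxy _ _ => covariance_rootedInnovation hT hd hreg hP hxy)
    exact h1.comp (fun _ f => f ()) fun _ => measurable_pi_apply _
  rw [(iIndepFun_iff_map_fun_eq_infinitePi_map fun x => measurable_rootedInnovation x).1 hind]
  congr 1
  funext x
  rw [(hgauss.hasGaussianLaw_eval x).map_eq_gaussianReal,
    variance_rootedInnovation hT hd hreg hP x, Real.toNNReal_coe]
  congr 1
  have h2 : P[rootedInnovation T d o x] = ∫ φ, φ x ∂P -
      ∫ φ, (if x = o then 0 else 1 / (d : ℝ)) * φ (parent T o x) ∂P :=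
    integral_sub ((hP.gaussian.hasGaussianLaw_eval x).integrable)
      ((hP.gaussian.hasGaussianLaw_eval _).integrable.const_mul _)
  rw [h2, integral_const_mul, hP.centred, hP.centred]
  simp

/-- The percolation probability of the free field, disintegrated along the root value. -/
lemma measure_infinite_eq_lintegral (hT : T.IsTree) (hd : 2 ≤ d)
    (hreg : T.IsRegularOfDegree (d + 1)) (hP : IsGFF T κ P) {A : Set V}
    (hA : ∀ x ∈ A, x ≠ o → parent T o x ∈ A) (hoA : o ∈ A) (h : ℝ) :
    P {φ | (cluster T o h φ ∩ A).Infinite} =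
      ∫⁻ a, condLaw T d κ o a {φ | (cluster T o h φ ∩ A).Infinite}
        ∂(gaussianReal 0 (fieldVariance d κ)) := by
  classical
  let L : Set (ℝ × (V → ℝ)) := {p | ∀ n, LineAbove (children T o A) d h n o p.1 p.2}
  have hL : MeasurableSet L := by
    have : L = ⋂ n, {p : ℝ × (V → ℝ) | LineAbove (children T o A) d h n o p.1 p.2} := by
      ext; simp [L]
    rw [this]
    exact MeasurableSet.iInter fun n => measurableSet_lineAbove _ n o
  have hdep : ∀ (a : ℝ) (Y Y' : V → ℝ), (∀ x, x ≠ o → Y x = Y' x) → ((a, Y) ∈ L ↔ (a, Y') ∈ L) :=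
    fun a Y Y' hY => forall_congr' fun n =>
      (dependsOn_lineAbove hT n o a fun x hx => hY x hx.2).to_iff
  have hm : Measurable (fun (φ : V → ℝ) x => rootedInnovation T d o x φ) :=
    measurable_pi_lambda _ measurable_rootedInnovation
  have h1 : {φ : V → ℝ | (cluster T o h φ ∩ A).Infinite} =
      (fun φ x => rootedInnovation T d o x φ) ⁻¹' {w : V → ℝ | (w o, w) ∈ L} := by
    ext φ
    simp only [Set.mem_preimage, Set.mem_ofPred_eq]
    rw [cluster_inter_infinite_iff (d := d) hT hA hoA, rootedInnovation_root]
    exact hdep _ _ _ fun x hx => (rootedInnovation_of_ne φ hx).symm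
  have hLm : MeasurableSet {w : V → ℝ | (w o, w) ∈ L} :=
    hL.preimage ((measurable_pi_apply o).prodMk measurable_id)
  conv_lhs => rw [h1]
  rw [← Measure.map_apply hm hLm, map_rootedInnovation hT hd hreg hP,
    ← map_piecewise_infinitePi (fun _ : V => gaussianReal 0 (fieldVariance d κ))
      (fun _ => innovationLaw d κ) {o} _
      (fun x hx => by rw [if_pos (Set.mem_singleton_iff.1 hx)])
      (fun x hx => by rw [if_neg fun h => hx (Set.mem_singleton_iff.2 h)]),
    Measure.map_apply (measurable_piecewise_prod _) hLm]
  have h2 : (fun p : (V → ℝ) × (V → ℝ) => ({o} : Set V).piecewise p.1 p.2) ⁻¹'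
      {w : V → ℝ | (w o, w) ∈ L} = {p | (p.1 o, p.2) ∈ L} := by
    ext p
    simp only [Set.mem_preimage, Set.mem_ofPred_eq]
    rw [Set.piecewise_eq_of_mem _ _ _ (Set.mem_singleton o)]
    exact hdep _ _ _ fun x hx => Set.piecewise_eq_of_notMem _ _ _ hx
  have hLm2 : MeasurableSet {p : (V → ℝ) × (V → ℝ) | (p.1 o, p.2) ∈ L} :=
    hL.preimage (f := fun p : (V → ℝ) × (V → ℝ) => (p.1 o, p.2)) (by fun_prop)
  rw [h2, Measure.prod_apply hLm2]
  simp_rw [condLaw_infinite_eq hT hA hoA κ]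
  have h3 := lintegral_map (μ := Measure.infinitePi fun _ : V => gaussianReal 0 (fieldVariance d κ))
    (measurable_measure_prodMk_left (ν := Measure.infinitePi fun _ : V => innovationLaw d κ) hL)
    (measurable_pi_apply o)
  rw [Measure.infinitePi_map_eval (fun _ : V => gaussianReal 0 (fieldVariance d κ)) o] at h3
  exact h3.symm

/-- A level is subcritical for the free field if and only if the survival recursion dies out. -/
lemma mem_subcriticalLevels_iff (hT : T.IsTree) (hd : 2 ≤ d)
    (hreg : T.IsRegularOfDegree (d + 1)) {obar : V} (ho : T.Adj o obar) (hκ : 0 < κ)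
    (hP : IsGFF T κ P) (h : ℝ) :
    h ∈ subcriticalLevels T o P ↔ ∀ b, survLim d (innovationLaw d κ) h b = 0 := by
  have hmain := measure_infinite_eq_lintegral hT hd hreg hP (o := o) (A := Set.univ)
    (fun _ _ _ => Set.mem_univ _) (Set.mem_univ o) h
  have hmeas := measurableSet_cluster_inter_infinite (h := h) (o := o) (A := Set.univ) hT
    (fun _ _ _ => Set.mem_univ _) (Set.mem_univ o)
  simp only [Set.inter_univ] at hmain hmeas
  change P _ = 0 ↔ _
  rw [hmain]
  constructor
  · intro h0 b
    by_contra hb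
    have hb0 : 0 < survLim d (innovationLaw d κ) h b :=
      lt_of_le_of_ne (survLim_mem b).1 (Ne.symm hb)
    have hpos : ∀ a ∈ Set.Ici b,
        ENNReal.ofReal (survLim d (innovationLaw d κ) h b) ≤
          condLaw T d κ o a {φ | (cluster T o h φ).Infinite} := by
      intro a ha
      rw [← ofReal_measureReal]
      refine ENNReal.ofReal_le_ofReal ((monotone_survLim ha).trans ?_)
      rw [← etaPlus_eq hT hreg ho]
      exact etaPlus_le_eta κ h a
    have h1 := setLIntegral_mono' (μ := gaussianReal 0 (fieldVariance d κ))
      (measurableSet_Ici (a := b)) hpos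
    rw [setLIntegral_const] at h1
    have h2 := (h1.trans (setLIntegral_le_lintegral _ _)).trans h0.le
    rw [nonpos_iff_eq_zero, mul_eq_zero] at h2
    rcases h2 with h2 | h2
    · exact absurd hb0 (not_lt.2 (ENNReal.ofReal_eq_zero.1 h2))
    · exact (gaussianReal_Ici_pos (fieldVariance_ne_zero hd hκ) 0 b).ne' h2
  · intro h0
    have : ∀ a, condLaw T d κ o a {φ | (cluster T o h φ).Infinite} = 0 := fun a =>
      (measureReal_eq_zero_iff (measure_ne_top _ _)).1 (eta_eq_zero hT hreg κ h0 a)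
    simp [this]

end IsGFF

end FreeField

end TreeGFF

open TreeGFF

theorem theorem1 {V : Type*} (d : ℕ) (hd : 2 ≤ d)
    (T : SimpleGraph V) [T.LocallyFinite] (hT : T.IsTree) (hreg : T.IsRegularOfDegree (d + 1))
    (o obar : V) (ho : T.Adj o obar)
    (κ : ℝ≥0) (hκ : 0 < κ)
    (P : Measure (V → ℝ)) (hP : TreeGFF.IsGFF T κ P) :
    IsGLB (TreeGFF.subcriticalLevels T o P) (TreeGFF.criticalHeight T o P) ∧
    (∀ a : ℝ,
      TreeGFF.eta T d κ o (TreeGFF.criticalHeight T o P) a = 0 ∧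
      TreeGFF.etaPlus T d κ o obar (TreeGFF.criticalHeight T o P) a = 0) ∧
    P {φ | (TreeGFF.cluster T o (TreeGFF.criticalHeight T o P) φ ∩
        TreeGFF.forwardTree T o obar).Infinite} = 0 ∧
    P {φ | (TreeGFF.cluster T o (TreeGFF.criticalHeight T o P) φ).Infinite} = 0 := by
  have hiff := IsGFF.mem_subcriticalLevels_iff hT hd hreg ho hκ hP
  have hv : κ * ((d : ℝ≥0) + 1) / (d : ℝ≥0) ≠ 0 := by
    have hd0 : (0 : ℝ≥0) < d := by exact_mod_cast (by omega : 0 < d)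
    positivity
  have hne : (subcriticalLevels T o P).Nonempty := by
    obtain ⟨h, hh⟩ := exists_survLim_eq_zero hd (κ * ((d : ℝ≥0) + 1) / (d : ℝ≥0))
    exact ⟨h, (hiff h).2 hh⟩
  have hbdd : BddBelow (subcriticalLevels T o P) := by
    obtain ⟨h, b, hb⟩ := exists_survLim_pos hd (κ * ((d : ℝ≥0) + 1) / (d : ℝ≥0))
    refine ⟨h, fun h' hh' => not_lt.1 fun hlt => hb.ne' ?_⟩
    exact (hiff h).1 (subcriticalLevels_upward hlt.le hh') b
  have hglb : IsGLB (subcriticalLevels T o P) (criticalHeight T o P) := isGLB_csInf hne hbdd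
  have hcrit : ∀ b, survLim d (innovationLaw d κ) (criticalHeight T o P) b = 0 := by
    intro b
    by_contra hb
    -- survival at the critical height would persist at a strictly higher level
    obtain ⟨h', hh', b', hb'⟩ := exists_gt_survLim_pos hd hv
      (lt_of_le_of_ne (survLim_mem b).1 (Ne.symm hb))
    obtain ⟨h'', hmem, hlt⟩ := (isGLB_lt_iff hglb).1 hh'
    exact hb'.ne' ((hiff h').1 (subcriticalLevels_upward hlt.le hmem) b')
  have hP0 : P {φ | (cluster T o (criticalHeight T o P) φ).Infinite} = 0 := (hiff _).2 hcrit
  exact ⟨hglb, fun a => ⟨eta_eq_zero hT hreg κ hcrit a,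
    (etaPlus_eq hT hreg ho κ _ a).trans (hcrit a)⟩,
    measure_mono_null (fun φ hφ => Set.Infinite.mono Set.inter_subset_left hφ) hP0, hP0⟩
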